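/- **Definitions.** A *word* is a finite string over the alphabet $\omega=\{0,1,2,\dots\}$; $\varLambda$ is the empty word. For $k\in\omega$ let $S_k$ be the set of words all of whose symbols are $\ge k$, and for $\alpha\in[0,\omega]$ let $W_\alpha$ be the set of words all of whose symbols are $\le\alpha$. Given a preorder $\precsim$ on words, with $A\sim B$ for "$A\precsim B$ and $B\precsim A$" and $A\prec B$ for "$A\precsim B$ and not $B\precsim A$", a finite sequence of words $(X_1,\dots,X_p)$ is *lexicographically not greater* than $(Y_1,\dots,Y_q)$ if either $p\le q$ and $X_i\sim Y_i$ for all $i\le p$, or for some $s<\min(p,q)$ we have $X_i\sim Y_i$ for all $i\le s$ and $X_{s+1}\prec Y_{s+1}$. The preorder $\precsim$ on words is defined recursively (on the difference between the maximal and the minimal symbol of $AB$): $\varLambda\precsim\varLambda$; and if $AB\ne\varLambda$ and $n$ is the minimal symbol of $AB$, write $A=A_1n\ldots nA_k$ and $B=B_1n\ldots nB_l$ with $k,l\ge 1$ and all $A_i,B_j\in S_{n+1}$; then $A\precsim B$ if and only if the lexicographically maximal subsequence of $(A_1,\dots,A_k)$ is lexicographically not greater than the lexicographically maximal subsequence of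 $(B_1,\dots,B_l)$. The set $\mathsf{NF}$ of words in *normal form* is defined by induction on length: $\varLambda\in\mathsf{NF}$; and for $k\ge2$ and $A_1,\dots,A_k\in S_{n+1}$, the word $A_1n\ldots nA_k$ is in $\mathsf{NF}$ if and only if $A_k\precsim\dots\precsim A_2\precsim A_1$ and $A_1,\dots,A_k\in\mathsf{NF}$. Every word is $\sim$-equivalent to exactly one word in normal form. Put $W^N_\alpha=W_\alpha\cap\mathsf{NF}$, and for $n\le\alpha$ and $A\in W^N_\alpha$ let $\langle n\rangle A\in W_\alpha^N$ be the word in normal form equivalent to the word $An$ ($A$ followed by the symbol $n$). **Theorem.** For every $\alpha$ with $3\le\alpha\le\omega$, the elementary theory $\mathbf{Th}(W^N_\alpha,\prec,\langle1\rangle,\langle3\rangle)$, i.e. the set of all first-order sentences (with equality) in the signature consisting of one binary relation symbol for $\prec$ and two unary function symbols for $\langle1\rangle$ and $\langle3\rangle$ that are true in this structure, is undecidable: the set of Gödel numbers of its members is not recursive. -/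

import Mathlib

namespace ReflectionWords

open FirstOrder

/-- Words over the alphabet of all natural numbers. The empty word is `[]`. -/
abbrev Word : Type := List ℕ

/-- `S k`: the words all of whose symbols are at least `k`. -/
def S (k : ℕ) : Set Word := {A | ∀ s ∈ A, k ≤ s}

/-- `W α`, for `α ≤ ω` (here `ω` is `⊤ : ℕ∞`): the words all of whose symbols are at most `α`. -/
def W (α : ℕ∞) : Set Word := {A | ∀ s ∈ A, (s : ℕ∞) ≤ α}

/-- `LexLE R X Y`: the sequence `X` is lexicographically not greater than the sequence `Y`, with
respect to the preorder `R`. Thus either the terms of `X` are `R`-equivalent to the first terms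
of `Y`, or at the first place where the sequences are not `R`-equivalent, the term of `X` is
strictly less than that of `Y`. -/
def LexLE (R : Word → Word → Prop) : List Word → List Word → Prop
  | [], _ => True
  | _ :: _, [] => False
  | x :: X, y :: Y => (R x y ∧ ¬ R y x) ∨ ((R x y ∧ R y x) ∧ LexLE R X Y)

/-- `C` is the lexicographically maximal subsequence of the sequence `X`. -/
def IsLexMaxSubseq (R : Word → Word → Prop) (C X : List Word) : Prop :=
  C.Sublist X ∧ ∀ D : List Word, D.Sublist X → LexLE R D C

/-- The comparison of words, by recursion on `r`. The value of `leAux r A B` is meaningful when,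
for some `n`, all symbols of `A ++ B` lie in the interval `[n, n + r)`. If `A ++ B` is not empty
and `n` is its minimal symbol, write `A = A₁ n A₂ n … n A_k` and `B = B₁ n B₂ n … n B_l`, where
no `A_i` and no `B_j` contains `n`, and compare lexicographically the lexicographically maximal
subsequences of `(A₁, …, A_k)` and of `(B₁, …, B_l)`. -/
def leAux : ℕ → Word → Word → Prop
  | 0, _, _ => True
  | r + 1, A, B =>
    match (A ++ B).min? with
    | none => True
    | some n => ∃ C D : List Word,
        IsLexMaxSubseq (leAux r) C (A.splitOn n) ∧
        IsLexMaxSubseq (leAux r) D (B.splitOn n) ∧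
        LexLE (leAux r) C D

/-- The preorder `A ≾ B` on words. All symbols of `A ++ B` are at most
`(A ++ B).foldr max 0`, the maximal symbol. -/
def LE (A B : Word) : Prop := leAux ((A ++ B).foldr max 0 + 1) A B

/-- The equivalence `A ∼ B` of words. -/
def Equiv (A B : Word) : Prop := LE A B ∧ LE B A

/-- The relation `A ≺ B` on words. -/
def LT (A B : Word) : Prop := LE A B ∧ ¬ LE B A

/-- Words in normal form: the empty word, and every word `A₁ n A₂ n … n A_k` with `k ≥ 2`, where
the `A_i` are words in normal form with all symbols greater than `n`, and
`A_k ≾ … ≾ A₂ ≾ A₁`. -/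
inductive NF : Word → Prop
  | nil : NF []
  | join (n : ℕ) (As : List Word) (hlen : 2 ≤ As.length)
      (hS : ∀ A ∈ As, A ∈ S (n + 1))
      (hmono : As.IsChain (fun X Y => LE Y X))
      (hNF : ∀ A ∈ As, NF A) :
      NF ([n].intercalate As)

/-- The set `W α ∩ NF`, as a type. -/
def WN (α : ℕ∞) : Type := {A : Word // A ∈ W α ∧ NF A}

/-- The empty word, as an element of `WN α`. -/
def WN.empty (α : ℕ∞) : WN α := ⟨[], by simp [W], NF.nil⟩

instance (α : ℕ∞) : Nonempty (WN α) := ⟨WN.empty α⟩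

/-- The operator `◇n` on `WN α` for `n ≤ α`: `◇n A` is the word in normal form that is equivalent
to `A n`. (Every word is equivalent to exactly one word in normal form, and that one uses no
symbol that is larger than all symbols of the given word.) -/
noncomputable def diamond (α : ℕ∞) (n : ℕ) (A : WN α) : WN α :=
  Classical.epsilon fun B : WN α => Equiv B.1 (A.1 ++ [n])

/-- Function symbols of the signature `(≺, ◇1, ◇3)`: two unary ones. -/
inductive Func : ℕ → Type
  | dia1 : Func 1
  | dia3 : Func 1

/-- Relation symbols of the signature `(≺, ◇1, ◇3)`: a binary one. -/
inductive Rel : ℕ → Type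
  | prec : Rel 2

/-- The signature `(≺, ◇1, ◇3)`. -/
def Lang : Language := ⟨Func, Rel⟩

/-- The structure `(WN α, ≺, ◇1, ◇3)`. -/
noncomputable instance (α : ℕ∞) : Lang.Structure (WN α) where
  funMap := fun {l} (f : Func l) =>
    match l, f with
    | _, Func.dia1 => fun x => diamond α 1 (x 0)
    | _, Func.dia3 => fun x => diamond α 3 (x 0)
  RelMap := fun {l} (R : Rel l) =>
    match l, R with
    | _, Rel.prec => fun x => LT (x 0).1 (x 1).1

/-- Gödel numbers of terms; the variables are the de Bruijn levels `0, …, n - 1`. -/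
def termCode {n : ℕ} : Lang.Term (Empty ⊕ Fin n) → ℕ
  | .var (.inl e) => e.elim
  | .var (.inr i) => Nat.pair 0 i
  | .func Func.dia1 ts => Nat.pair 1 (termCode (ts 0))
  | .func Func.dia3 ts => Nat.pair 2 (termCode (ts 0))

/-- Gödel numbers of formulas. -/
def formulaCode : {n : ℕ} → Lang.BoundedFormula Empty n → ℕ
  | _, .falsum => Nat.pair 0 0
  | _, .equal t u => Nat.pair 1 (Nat.pair (termCode t) (termCode u))
  | _, .rel Rel.prec ts => Nat.pair 2 (Nat.pair (termCode (ts 0)) (termCode (ts 1)))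
  | _, .imp φ ψ => Nat.pair 3 (Nat.pair (formulaCode φ) (formulaCode ψ))
  | _, .all φ => Nat.pair 4 (formulaCode φ)

theorem termCode_injective {n : ℕ} : Function.Injective (termCode (n := n)) := by
  intro t
  induction t with
  | var x =>
    rcases x with e | i
    · exact e.elim
    · intro u h
      cases u with
      | var y =>
        rcases y with e | j
        · exact e.elim
        · simp only [termCode, Nat.pair_eq_pair, true_and] at h
          rw [Fin.ext h]
      | func g us => cases g <;> simp [termCode] at h
  | func f ts ih =>
    intro u h
    cases u with
    | var y =>
      rcases y with e | j
      · exact e.elim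
      · cases f <;> simp [termCode] at h
    | func g us =>
      cases f <;> cases g <;> simp [termCode] at h
      all_goals
        congr 1
        funext i
        rw [Subsingleton.elim i 0]
        exact ih 0 h

theorem formulaCode_injective {n : ℕ} :
    Function.Injective (formulaCode (n := n)) := by
  intro φ
  induction φ with
  | falsum => intro ψ h; cases ψ with
    | falsum => rfl
    | rel R us => cases R; simp [formulaCode] at h
    | _ => simp [formulaCode] at h
  | equal t u => intro ψ h; cases ψ with
    | equal t' u' =>
      simp only [formulaCode, Nat.pair_eq_pair, true_and] at h
      rw [termCode_injective h.1, termCode_injective h.2]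
    | rel R us => cases R; simp [formulaCode] at h
    | _ => simp [formulaCode] at h
  | rel R ts => intro ψ h; cases R; cases ψ with
    | rel R' us =>
      cases R'
      simp only [formulaCode, Nat.pair_eq_pair, true_and] at h
      congr 1
      funext i
      have h01 := And.intro (termCode_injective h.1) (termCode_injective h.2)
      revert i
      exact Fin.forall_fin_two.2 h01
    | _ => simp [formulaCode] at h
  | imp φ₁ φ₂ ih₁ ih₂ => intro ψ h; cases ψ with
    | imp ψ₁ ψ₂ =>
      simp only [formulaCode, Nat.pair_eq_pair, true_and] at h
      rw [ih₁ h.1, ih₂ h.2]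
    | rel R us => cases R; simp [formulaCode] at h
    | _ => simp [formulaCode] at h
  | all φ ih => intro ψ h; cases ψ with
    | all ψ =>
      simp only [formulaCode, Nat.pair_eq_pair, true_and] at h
      rw [ih h]
    | rel R us => cases R; simp [formulaCode] at h
    | _ => simp [formulaCode] at h

/-- A set of sentences is decidable if the set of the Gödel numbers of its members is
recursive. -/
def DecidableTheory (T : Lang.Theory) : Prop :=
  ComputablePred fun k : ℕ => ∃ φ : Lang.Sentence, φ ∈ T ∧ formulaCode φ = k

end ReflectionWords

namespace ReflectionWords

open Ordinal Filter

/-! ### Ordinal sums of powers of `ω` -/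

/-! A word `A` gets an ordinal at every level `n`: if the symbol `n` cuts `A` into blocks `A₁, …,
A_k`, then `1 + ord n A` is the sum of the `ω ^ ord (n + 1) A_i`. A term of this sum is absorbed by
a larger later one exactly when the block is dropped from the lexicographically maximal subsequence.
Hence `≾` is comparison of `ord 0` (`le_iff`), and a normal form is determined by its ordinal
(`NF.ord_injective`). Appending a symbol acts on the last block only; in particular `◇1` turns the
last term `ω ^ ζ` of `1 + ord 0` into `ω ^ (ζ + 1)`.

It follows that the `z` with `z ≼ b ≺ ◇1 z` are exactly the partial sums of the Cantor normal form
of `b`. So `b` defines a finite increasing sequence of elements, and `◇3` reads a number off each of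
them: for every `k` there is `c` such that every nonempty sequence `d₀, d₁, …` of numbers `≤ k` has
a `b` whose `i`-th partial sum `y` satisfies `◇3 y = ◇3 ^ d_i c` (`exists_coding`). This works
because the last block of `y`, once raised by `◇3`, absorbs all data before it. What remains is
`staircase (k - d_i) d_i ++ [3]`, and the same ordinal is reached from `c` since each further symbol
`3` absorbs one step of the staircase.

The number `j` is then represented by `◇3 ^ (j + 1) c`, and `c` itself serves as separator. A
recursively defined relation is expressed by the existence of a code of a derivation. As `≺` is well
founded, whatever such a code proves is correct for every `c` (`Path.induction`); conversely a given
derivation has a code as soon as `k` is large (`path_of_codes`). By induction on `Nat.Partrec`, each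
partial recursive `F` gets a formula that holds at `n` for some `c` if and only if `F n` is defined,
so a decision procedure for the theory would solve the halting problem. -/

/-- The ordinal `ω ^ ξ₁ + … + ω ^ ξ_k`. -/
noncomputable def opowSum (L : List Ordinal.{0}) : Ordinal.{0} := (L.map fun ξ => ω ^ ξ).sum

@[simp] theorem opowSum_nil : opowSum [] = 0 := rfl

@[simp] theorem opowSum_cons (ξ : Ordinal) (L : List Ordinal) :
    opowSum (ξ :: L) = ω ^ ξ + opowSum L := by simp [opowSum]

@[simp] theorem opowSum_append (L L' : List Ordinal) :
    opowSum (L ++ L') = opowSum L + opowSum L' := by simp [opowSum]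

theorem omega_opow_pos (ξ : Ordinal) : 0 < ω ^ ξ := opow_pos _ omega0_pos

theorem opow_omega_lt {ξ η : Ordinal} (h : ξ < η) : ω ^ ξ < ω ^ η :=
  (opow_lt_opow_iff_right one_lt_omega0).2 h

theorem opow_omega_le {ξ η : Ordinal} (h : ξ ≤ η) : ω ^ ξ ≤ ω ^ η :=
  (opow_le_opow_iff_right one_lt_omega0).2 h

theorem opow_omega_inj {ξ η : Ordinal} (h : ω ^ ξ = ω ^ η) : ξ = η :=
  (opow_right_inj one_lt_omega0).1 h

theorem opowSum_pos {L : List Ordinal} (h : L ≠ []) : 0 < opowSum L := by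
  cases L with
  | nil => exact absurd rfl h
  | cons ξ L => exact (omega_opow_pos ξ).trans_le (by simp)

theorem one_le_opowSum {L : List Ordinal} (h : L ≠ []) : 1 ≤ opowSum L :=
  Order.one_le_iff_pos.2 (opowSum_pos h)

theorem opowSum_lt {L : List Ordinal} {η : Ordinal} (h : ∀ ξ ∈ L, ξ < η) :
    opowSum L < ω ^ η := by
  induction L with
  | nil => exact omega_opow_pos η
  | cons ξ L ih =>
    rw [opowSum_cons]
    exact isPrincipal_add_omega0_opow η (opow_omega_lt (h ξ (by simp)))
      (ih fun x hx => h x (by simp [hx]))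

theorem opowSum_absorb {L : List Ordinal} {ξ y : Ordinal} (hy : y ∈ L) (h : ξ < y) :
    ω ^ ξ + opowSum L = opowSum L := by
  induction L generalizing ξ with
  | nil => simp at hy
  | cons z L ih =>
    rw [opowSum_cons]
    rcases lt_or_ge ξ z with hz | hz
    -- If the first term does not exceed `ξ`, then it is itself absorbed by `y` and may be dropped.
    · rw [← add_assoc, add_omega0_opow (opow_omega_lt hz)]
    · rcases List.mem_cons.1 hy with rfl | hy
      · exact absurd h hz.not_gt
      · rw [ih hy (hz.trans_lt h), ih hy h]

/-- The lexicographic order on finite sequences of ordinals. -/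
def OrdLexLE : List Ordinal.{0} → List Ordinal.{0} → Prop
  | [], _ => True
  | _ :: _, [] => False
  | x :: X, y :: Y => x < y ∨ (x = y ∧ OrdLexLE X Y)

theorem OrdLexLE.antisymm {X Y : List Ordinal} (h : OrdLexLE X Y) (h' : OrdLexLE Y X) :
    X = Y := by
  induction X generalizing Y with
  | nil => cases Y with
    | nil => rfl
    | cons => exact h'.elim
  | cons x X ih => cases Y with
    | nil => exact h.elim
    | cons y Y =>
      rcases h with h | ⟨rfl, h⟩ <;> rcases h' with h' | ⟨e, h'⟩
      · exact absurd h h'.not_gt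
      · exact absurd h e.not_gt
      · exact absurd h' (lt_irrefl _)
      · rw [ih h h']

/-- Nonincreasing sequences of ordinals. -/
abbrev Nonincreasing (X : List Ordinal.{0}) : Prop := X.Pairwise (· ≥ ·)

theorem opowSum_le_iff {X Y : List Ordinal} (hX : Nonincreasing X) (hY : Nonincreasing Y) :
    opowSum X ≤ opowSum Y ↔ OrdLexLE X Y := by
  have key : ∀ {x y : Ordinal} {X Y : List Ordinal}, Nonincreasing (x :: X) → x < y →
      opowSum (x :: X) < opowSum (y :: Y) := by
    intro x y X Y hX hxy
    refine (opowSum_lt (η := y) fun z hz => ?_).trans_le (by simp)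
    rcases List.mem_cons.1 hz with rfl | hz
    · exact hxy
    · exact (List.rel_of_pairwise_cons hX hz).trans_lt hxy
  induction X generalizing Y with
  | nil => simp [OrdLexLE]
  | cons x X ih => cases Y with
    | nil => simp [OrdLexLE]
    | cons y Y =>
      rcases lt_trichotomy x y with h | rfl | h
      · simp only [OrdLexLE, h, true_or, iff_true]
        exact (key hX h).le
      · simp [OrdLexLE, ih hX.of_cons hY.of_cons]
      · simp only [OrdLexLE, h.not_gt, h.ne', false_and, or_false, iff_false, not_le]
        exact key hY h

theorem opowSum_injective {X Y : List Ordinal} (hX : Nonincreasing X) (hY : Nonincreasing Y)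
    (h : opowSum X = opowSum Y) : X = Y :=
  ((opowSum_le_iff hX hY).1 h.le).antisymm ((opowSum_le_iff hY hX).1 h.ge)

open Classical in
/-- The lexicographically maximal subsequence of a sequence of ordinals. -/
noncomputable def lexMax : List Ordinal.{0} → List Ordinal.{0}
  | [] => []
  | x :: L => if ∃ y ∈ L, x < y then lexMax L else x :: lexMax L

theorem lexMax_sublist (L : List Ordinal) : (lexMax L).Sublist L := by
  induction L with
  | nil => simp [lexMax]
  | cons x L ih =>
    rw [lexMax]
    split_ifs
    · exact ih.cons x
    · exact ih.cons_cons x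

theorem lexMax_nonincreasing (L : List Ordinal) : Nonincreasing (lexMax L) := by
  induction L with
  | nil => simp [lexMax]
  | cons x L ih =>
    rw [lexMax]
    split_ifs with h
    · exact ih
    · push Not at h
      exact List.pairwise_cons.2 ⟨fun y hy => h y ((lexMax_sublist L).subset hy), ih⟩

/-- The terms that `lexMax` drops are those below a later term, which are absorbed in the sum. Being
nonincreasing, `lexMax L` lists the exponents of the Cantor normal form. -/
theorem opowSum_lexMax (L : List Ordinal) : opowSum (lexMax L) = opowSum L := by
  induction L with
  | nil => simp [lexMax]
  | cons x L ih =>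
    rw [lexMax]
    split_ifs with h
    · obtain ⟨y, hy, hxy⟩ := h
      rw [ih, opowSum_cons, opowSum_absorb hy hxy]
    · rw [opowSum_cons, ih, opowSum_cons]

theorem lexMax_ne_nil {L : List Ordinal} (h : L ≠ []) : lexMax L ≠ [] := fun e =>
  (opowSum_pos h).ne' (by rw [← opowSum_lexMax, e, opowSum_nil])

theorem le_lexMax {D L : List Ordinal} (hD : D.Sublist L) : OrdLexLE D (lexMax L) := by
  induction L generalizing D with
  | nil => rw [List.sublist_nil.1 hD]; trivial
  | cons x L ih =>
    rw [lexMax]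
    split_ifs with hx
    · rcases List.sublist_cons_iff.1 hD with h | ⟨D, rfl, h⟩
      · exact ih h
      · obtain ⟨y, hy, hxy⟩ := hx
        -- The one-term subsequence `[y]` shows that `lexMax L` begins with a term `≥ y > x`, so a
        -- subsequence that keeps `x` loses at its first place.
        have := ih (List.singleton_sublist.2 hy)
        cases hL : lexMax L with
        | nil => rw [hL] at this; exact this.elim
        | cons z Z =>
          rw [hL] at this
          rcases this with h | ⟨rfl, -⟩
          · exact Or.inl (hxy.trans h)
          · exact Or.inl hxy
    · push Not at hx
      rcases List.sublist_cons_iff.1 hD with h | ⟨D, rfl, h⟩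
      · cases D with
        | nil => trivial
        | cons d D =>
          rcases (hx d (h.subset (by simp))).lt_or_eq with hd | hd
          · exact Or.inl hd
          · exact Or.inr ⟨hd, ih ((List.sublist_cons_self _ _).trans h)⟩
      · exact Or.inr ⟨rfl, ih h⟩

theorem lexLE_iff {R : Word → Word → Prop} {f : Word → Ordinal} {G : Set Word}
    (hR : ∀ x ∈ G, ∀ y ∈ G, (R x y ↔ f x ≤ f y)) {X Y : List Word} (hX : ∀ x ∈ X, x ∈ G)
    (hY : ∀ y ∈ Y, y ∈ G) : LexLE R X Y ↔ OrdLexLE (X.map f) (Y.map f) := by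
  induction X generalizing Y with
  | nil => simp [LexLE, OrdLexLE]
  | cons x X ih => cases Y with
    | nil => simp [LexLE, OrdLexLE]
    | cons y Y =>
      have hx := hX x (by simp)
      have hy := hY y (by simp)
      simp only [LexLE, List.map_cons, OrdLexLE, hR x hx y hy, hR y hy x hx, not_le]
      rw [ih (fun z hz => hX z (by simp [hz])) fun z hz => hY z (by simp [hz])]
      refine or_congr ⟨And.right, fun h => ⟨h.le, h⟩⟩ (and_congr_left fun _ => ?_)
      exact le_antisymm_iff.symm

/-- A maximal subsequence of words is unique only up to equivalence; passing to the ordinals `f`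
removes this ambiguity. -/
theorem isLexMaxSubseq_iff {R : Word → Word → Prop} {f : Word → Ordinal} {G : Set Word}
    (hR : ∀ x ∈ G, ∀ y ∈ G, (R x y ↔ f x ≤ f y)) {C X : List Word} (hX : ∀ x ∈ X, x ∈ G) :
    IsLexMaxSubseq R C X ↔ C.Sublist X ∧ C.map f = lexMax (X.map f) := by
  refine and_congr_right fun hC => ⟨fun h => ?_, fun h D hD => ?_⟩
  · obtain ⟨D, hD, e⟩ := List.sublist_map_iff.1 (lexMax_sublist (X.map f))
    refine (le_lexMax (hC.map f)).antisymm ?_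
    rw [e]
    exact (lexLE_iff hR (fun x hx => hX x (hD.subset hx))
      fun x hx => hX x (hC.subset hx)).1 (h D hD)
  · rw [lexLE_iff hR (fun x hx => hX x (hD.subset hx)) fun x hx => hX x (hC.subset hx), h]
    exact le_lexMax (hD.map f)

/-! ### The ordinal of a word -/

/-- Approximations of `ord`: the words have symbols less than `n + r`. -/
noncomputable def ordAux : ℕ → ℕ → Word → Ordinal.{0}
  | 0, _, _ => 0
  | r + 1, n, A => opowSum ((A.splitOn n).map (ordAux r (n + 1))) - 1

/-- The ordinal of a word `A` at the level `n`: if `A = A₁ n … n A_k`, then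
`1 + ord n A = ω ^ ord (n + 1) A₁ + … + ω ^ ord (n + 1) A_k`. -/
noncomputable def ord (n : ℕ) (A : Word) : Ordinal.{0} := ordAux (A.foldr max 0 + 1) n A

theorem mem_of_mem_splitOn {A B : Word} {n s : ℕ} (hB : B ∈ A.splitOn n) (hs : s ∈ B) :
    s ∈ A := by
  induction A generalizing B with
  | nil => simp at hB; simp [hB] at hs
  | cons a A ih =>
    rw [List.splitOn_cons_eq_if_modifyHead] at hB
    split_ifs at hB
    · rcases List.mem_cons.1 hB with rfl | hB
      · simp at hs
      · simp [ih hB hs]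
    · cases hA : A.splitOn n with
      | nil => simp at hA
      | cons C L =>
        rw [hA, List.modifyHead_cons] at hB
        rcases List.mem_cons.1 hB with rfl | hB
        · rcases List.mem_cons.1 hs with rfl | hs
          · simp
          · simp [ih (by rw [hA]; simp) hs]
        · simp [ih (by rw [hA]; simp [hB]) hs]

theorem notMem_of_mem_splitOn {A B : Word} {n : ℕ} (hB : B ∈ A.splitOn n) : n ∉ B := by
  induction A generalizing B with
  | nil => simp at hB; simp [hB]
  | cons a A ih =>
    rw [List.splitOn_cons_eq_if_modifyHead] at hB
    split_ifs at hB with ha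
    · rcases List.mem_cons.1 hB with rfl | hB
      · simp
      · exact ih hB
    · cases hA : A.splitOn n with
      | nil => simp at hA
      | cons C L =>
        rw [hA, List.modifyHead_cons] at hB
        rcases List.mem_cons.1 hB with rfl | hB
        · simp only [List.mem_cons, not_or]
          exact ⟨fun h => ha (by simp [h]), ih (by rw [hA]; simp)⟩
        · exact ih (by rw [hA]; simp [hB])

theorem ordAux_succ {r n : ℕ} {A : Word} (h : ∀ s ∈ A, s < n + r) :
    ordAux (r + 1) n A = ordAux r n A := by
  induction r generalizing n A with
  | zero =>
    -- There is a single block, of value `0`, and `ω ^ 0 - 1 = 0`.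
    rw [ordAux.eq_2, List.splitOn_eq_singleton fun hn => absurd (h n hn) (by simp)]
    simp [ordAux]
  | succ r ih =>
    rw [ordAux, ordAux.eq_2 n A r]
    congr 2
    refine List.map_congr_left fun B hB => ih fun s hs => ?_
    have := h s (mem_of_mem_splitOn hB hs)
    omega

theorem ordAux_eq_of_le {r r' n : ℕ} {A : Word} (h : ∀ s ∈ A, s < n + r) (hr : r ≤ r') :
    ordAux r' n A = ordAux r n A := by
  induction r', hr using Nat.le_induction with
  | base => rfl
  | succ r' hr ih => rw [ordAux_succ fun s hs => (h s hs).trans_le (by omega), ih]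

theorem le_foldr_max {A : Word} {s : ℕ} (hs : s ∈ A) : s ≤ A.foldr max 0 := by
  induction A with
  | nil => simp at hs
  | cons a A ih => rcases List.mem_cons.1 hs with rfl | hs <;> simp_all

theorem ordAux_eq_ord {r n : ℕ} {A : Word} (h : ∀ s ∈ A, s < n + r) :
    ordAux r n A = ord n A := by
  have h' : ∀ s ∈ A, s < n + (A.foldr max 0 + 1) := fun s hs => by
    have := le_foldr_max hs
    omega
  rcases le_total r (A.foldr max 0 + 1) with hr | hr
  · exact (ordAux_eq_of_le h hr).symm
  · exact ordAux_eq_of_le h' hr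

/-- `1 + ord n A`. -/
noncomputable def oneAddOrd (n : ℕ) (A : Word) : Ordinal.{0} := 1 + ord n A

/-- The sum has at least one term, since even the empty word has one (empty) block. Hence it is `≥
1`, and the left subtraction of `1`, which gives the empty word the ordinal `0`, can be undone. -/
theorem oneAddOrd_eq (n : ℕ) (A : Word) :
    oneAddOrd n A = opowSum ((A.splitOn n).map (ord (n + 1))) := by
  have h : ∀ s ∈ A, s < n + 1 + (A.foldr max 0 + 1) := fun s hs => by
    have := le_foldr_max hs
    omega
  have e : (A.splitOn n).map (ord (n + 1)) =
      (A.splitOn n).map (ordAux (A.foldr max 0 + 1) (n + 1)) :=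
    List.map_congr_left fun B hB => (ordAux_eq_ord fun s hs => h s (mem_of_mem_splitOn hB hs)).symm
  rw [oneAddOrd, ← ordAux_eq_ord (r := A.foldr max 0 + 1 + 1) (fun s hs => by have := h s hs; omega),
    ordAux, e, Ordinal.add_sub_cancel_of_le (one_le_opowSum (by simp))]

theorem ord_lt_iff {n : ℕ} {A B : Word} : ord n A < ord n B ↔ oneAddOrd n A < oneAddOrd n B := by
  simp [oneAddOrd]

theorem ord_le_iff {n : ℕ} {A B : Word} : ord n A ≤ ord n B ↔ oneAddOrd n A ≤ oneAddOrd n B := by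
  simp [oneAddOrd]

theorem ord_eq_iff {n : ℕ} {A B : Word} : ord n A = ord n B ↔ oneAddOrd n A = oneAddOrd n B := by
  simp [oneAddOrd]

theorem oneAddOrd_of_notMem {n : ℕ} {A : Word} (h : n ∉ A) :
    oneAddOrd n A = ω ^ ord (n + 1) A := by
  rw [oneAddOrd_eq, List.splitOn_eq_singleton h]
  simp

theorem oneAddOrd_append_cons (n : ℕ) (A B : Word) :
    oneAddOrd n (A ++ n :: B) = oneAddOrd n A + oneAddOrd n B := by
  simp only [oneAddOrd_eq, List.splitOn_append_cons_self, List.map_append, opowSum_append]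

theorem ord_nil (n : ℕ) : ord n [] = 0 := by
  rw [← ordAux_eq_ord (r := 0) (by simp), ordAux]

theorem oneAddOrd_nil (n : ℕ) : oneAddOrd n [] = 1 := by
  simp [oneAddOrd, ord_nil]

theorem ord_le_succ_iff {n : ℕ} {A B : Word} (hA : n ∉ A) (hB : n ∉ B) :
    ord n A ≤ ord n B ↔ ord (n + 1) A ≤ ord (n + 1) B := by
  rw [ord_le_iff, oneAddOrd_of_notMem hA, oneAddOrd_of_notMem hB,
    opow_le_opow_iff_right one_lt_omega0]

/-- At a level whose symbol does not occur, `1 + ord` is a single power of `ω`, which preserves and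
reflects order. The minimal symbol in the definition of `≾` can therefore be replaced by any smaller
level, in particular by `0`. -/
theorem ord_le_iff_of_mem_S {n m : ℕ} (h : n ≤ m) {A B : Word} (hA : A ∈ S m) (hB : B ∈ S m) :
    ord n A ≤ ord n B ↔ ord m A ≤ ord m B := by
  induction m, h using Nat.le_induction with
  | base => rfl
  | succ m hm ih =>
    have hs : ∀ {C : Word}, C ∈ S (m + 1) → C ∈ S m := fun h s hs => by
      have := h s hs
      omega
    have hn : ∀ {C : Word}, C ∈ S (m + 1) → m ∉ C := fun h hs => by
      have := h m hs
      omega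
    rw [ih (hs hA) (hs hB), ord_le_succ_iff (hn hA) (hn hB)]

theorem leAux_iff {r n : ℕ} {A B : Word} (hA : A ∈ S n) (hB : B ∈ S n)
    (hA' : ∀ s ∈ A, s < n + r) (hB' : ∀ s ∈ B, s < n + r) :
    leAux r A B ↔ ord n A ≤ ord n B := by
  induction r generalizing n A B with
  | zero =>
    have : ∀ {C : Word}, C ∈ S n → (∀ s ∈ C, s < n + 0) → C = [] := fun h h' =>
      List.eq_nil_iff_forall_not_mem.2 fun s hs => absurd (h s hs) (by have := h' s hs; omega)
    rw [this hA hA', this hB hB']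
    simp [leAux]
  | succ r ih =>
    rw [leAux]
    cases hm : (A ++ B).min? with
    | none =>
      obtain ⟨rfl, rfl⟩ := List.append_eq_nil_iff.1 (List.min?_eq_none_iff.1 hm)
      simp
    | some m =>
      obtain ⟨hmem, hmin⟩ := List.min?_eq_some_iff.1 hm
      have hnm : n ≤ m := by
        rcases List.mem_append.1 hmem with h | h
        · exact hA m h
        · exact hB m h
      have hAm : A ∈ S m := fun s hs => hmin s (by simp [hs])
      have hBm : B ∈ S m := fun s hs => hmin s (by simp [hs])
      have hG : ∀ {C : Word}, C ∈ S m → (∀ s ∈ C, s < n + (r + 1)) → ∀ x ∈ C.splitOn m,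
          x ∈ {D | D ∈ S (m + 1) ∧ ∀ s ∈ D, s < m + 1 + r} := by
        refine fun hC hC' x hx => ⟨fun s hs => ?_, fun s hs => ?_⟩
        · have h1 := hC s (mem_of_mem_splitOn hx hs)
          have h2 : s ≠ m := fun e => notMem_of_mem_splitOn hx (e ▸ hs)
          omega
        · have := hC' s (mem_of_mem_splitOn hx hs)
          omega
      have hR : ∀ x ∈ {D : Word | D ∈ S (m + 1) ∧ ∀ s ∈ D, s < m + 1 + r},
          ∀ y ∈ {D : Word | D ∈ S (m + 1) ∧ ∀ s ∈ D, s < m + 1 + r},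
          (leAux r x y ↔ ord (m + 1) x ≤ ord (m + 1) y) :=
        fun x hx y hy => ih hx.1 hy.1 hx.2 hy.2
      simp only [isLexMaxSubseq_iff hR (hG hAm hA'), isLexMaxSubseq_iff hR (hG hBm hB')]
      rw [ord_le_iff_of_mem_S hnm hAm hBm, ord_le_iff, oneAddOrd_eq, oneAddOrd_eq,
        ← opowSum_lexMax, ← opowSum_lexMax (List.map _ (B.splitOn m)),
        opowSum_le_iff (lexMax_nonincreasing _) (lexMax_nonincreasing _)]
      constructor
      · rintro ⟨C, D, ⟨hC, eC⟩, ⟨hD, eD⟩, h⟩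
        rw [← eC, ← eD]
        exact (lexLE_iff hR (fun x hx => hG hAm hA' x (hC.subset hx))
          fun x hx => hG hBm hB' x (hD.subset hx)).1 h
      · intro h
        obtain ⟨C, hC, eC⟩ := List.sublist_map_iff.1 (lexMax_sublist ((A.splitOn m).map (ord (m + 1))))
        obtain ⟨D, hD, eD⟩ := List.sublist_map_iff.1 (lexMax_sublist ((B.splitOn m).map (ord (m + 1))))
        refine ⟨C, D, ⟨hC, eC.symm⟩, ⟨hD, eD.symm⟩, ?_⟩
        rw [lexLE_iff hR (fun x hx => hG hAm hA' x (hC.subset hx))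
          fun x hx => hG hBm hB' x (hD.subset hx), ← eC, ← eD]
        exact h

theorem le_iff {A B : Word} : LE A B ↔ ord 0 A ≤ ord 0 B := by
  refine leAux_iff (fun _ _ => Nat.zero_le _) (fun _ _ => Nat.zero_le _) ?_ ?_
  all_goals
    intro s hs
    have := le_foldr_max (A := A ++ B) (s := s) (by simp [hs])
    omega

theorem lt_iff {A B : Word} : LT A B ↔ ord 0 A < ord 0 B := by
  rw [LT, le_iff, le_iff, not_le]
  exact ⟨And.right, fun h => ⟨h.le, h⟩⟩

theorem equiv_iff {A B : Word} : Equiv A B ↔ ord 0 A = ord 0 B := by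
  rw [Equiv, le_iff, le_iff, le_antisymm_iff]

/-- The last exponent of a sum is determined by its value. If `v = u + ρ` gives the same sum, then
`ρ` is absorbed by `ω ^ ζ`, hence by every higher power. This makes raising the last exponent
independent of the way in which the sum is written. -/
theorem add_opow_eq_add_opow {u v ζ ζ' : Ordinal.{0}} (h : u + ω ^ ζ = v + ω ^ ζ') :
    ζ = ζ' ∧ ∀ η, ζ ≤ η → u + ω ^ η = v + ω ^ η := by
  have key : ∀ {u v ζ ζ' : Ordinal.{0}}, ζ < ζ' → u + ω ^ ζ < v + ω ^ ζ' ∨ v + ω ^ ζ' ≤ u := by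
    intro u v ζ ζ' hz
    -- Since `ω ^ ζ'` is additively principal, adding a smaller power to something below `v + ω ^
    -- ζ'` does not reach it.
    by_cases hu : u < v + ω ^ ζ'
    · left
      obtain ⟨d, hd, hle⟩ := (lt_add_iff (omega_opow_pos ζ').ne').1 hu
      calc u + ω ^ ζ ≤ v + d + ω ^ ζ := by gcongr
        _ = v + (d + ω ^ ζ) := add_assoc _ _ _
        _ < v + ω ^ ζ' := by
          gcongr
          exact isPrincipal_add_omega0_opow ζ' hd (opow_omega_lt hz)
    · exact Or.inr (not_lt.1 hu)
  have key' : ∀ {u v ζ ζ' : Ordinal.{0}}, u + ω ^ ζ = v + ω ^ ζ' → ¬ ζ < ζ' := by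
    intro u v ζ ζ' h hz
    rcases key (u := u) (v := v) hz with h' | h'
    · exact h'.ne h
    · rw [← h] at h'
      exact absurd h' (not_le.2 (lt_add_of_pos_right u (omega_opow_pos ζ)))
  obtain rfl : ζ = ζ' := le_antisymm (not_lt.1 (key' h.symm)) (not_lt.1 (key' h))
  have abs : ∀ {u v : Ordinal.{0}}, u ≤ v → u + ω ^ ζ = v + ω ^ ζ → ∀ η, ζ ≤ η →
      u + ω ^ η = v + ω ^ η := by
    intro u v huv h η hη
    obtain ⟨ρ, rfl⟩ := exists_add_of_le huv
    rw [add_assoc, add_right_inj] at h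
    have hρ : ρ < ω ^ ζ := by
      refine lt_of_le_of_ne (by rw [h]; exact le_self_add) fun e => ?_
      rw [e] at h
      exact (lt_add_of_pos_right (ω ^ ζ) (omega_opow_pos ζ)).ne h
    rw [add_assoc, add_omega0_opow (hρ.trans_le (opow_omega_le hη))]
  refine ⟨rfl, fun η hη => ?_⟩
  rcases le_total u v with huv | huv
  · exact abs huv h η hη
  · exact (abs huv h.symm η hη).symm

/-- The last block of a word, and the ordinals of the blocks before it. -/
theorem exists_lastBlock (n : ℕ) (A : Word) : ∃ (Z : List Ordinal.{0}) (B : Word), n ∉ B ∧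
    ∀ E : Word, n ∉ E → oneAddOrd n (A ++ E) = opowSum Z + ω ^ ord (n + 1) (B ++ E) := by
  by_cases hn : n ∈ A
  · obtain ⟨I, B, rfl, hB⟩ : ∃ I B, A = I ++ n :: B ∧ n ∉ B := by
      obtain ⟨s, t, h, hs⟩ := List.eq_append_cons_of_mem (List.mem_reverse.2 hn)
      refine ⟨t.reverse, s.reverse, ?_, by simpa using hs⟩
      rw [← List.reverse_reverse A, h]
      simp
    refine ⟨(I.splitOn n).map (ord (n + 1)), B, hB, fun E hE => ?_⟩
    rw [List.append_assoc, List.cons_append, oneAddOrd_append_cons, ← oneAddOrd_eq,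
      oneAddOrd_of_notMem (A := B ++ E) (by simp [hB, hE])]
  · exact ⟨[], A, hn, fun E hE => by rw [oneAddOrd_of_notMem (by simp [hn, hE])]; simp⟩

/-- At the level of the appended symbol a term `1` is added; at each lower level the last exponent
grows. -/
theorem ord_lt_ord_append (A : Word) {n m : ℕ} (h : n ≤ m) : ord n A < ord n (A ++ [m]) := by
  obtain ⟨j, rfl⟩ := Nat.exists_eq_add_of_le h
  clear h
  rw [ord_lt_iff]
  induction j generalizing n A with
  | zero => simp [oneAddOrd_append_cons, oneAddOrd_nil]
  | succ j ih =>
    obtain ⟨Z, B, -, hE⟩ := exists_lastBlock n A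
    have h0 := hE [] (by simp)
    simp only [List.append_nil] at h0
    rw [h0, hE _ (by simp), ← add_assoc, add_right_comm]
    gcongr
    exact opow_omega_lt (ord_lt_iff.2 (ih B))

/-- Appending a symbol above the level raises the last exponent only, so `add_opow_eq_add_opow`
applies level by level. -/
theorem ord_append_congr {A B : Word} {n m : ℕ} (h : n ≤ m) (hAB : ord n A = ord n B) :
    ord n (A ++ [m]) = ord n (B ++ [m]) := by
  obtain ⟨j, rfl⟩ := Nat.exists_eq_add_of_le h
  clear h
  rw [ord_eq_iff] at hAB ⊢
  induction j generalizing n A B with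
  | zero => simp [oneAddOrd_append_cons, hAB]
  | succ j ih =>
    obtain ⟨Z, C, -, hC⟩ := exists_lastBlock n A
    obtain ⟨Z', C', -, hC'⟩ := exists_lastBlock n B
    have h0 := hC [] (by simp)
    have h0' := hC' [] (by simp)
    simp only [List.append_nil] at h0 h0'
    rw [h0, h0'] at hAB
    obtain ⟨e, hη⟩ := add_opow_eq_add_opow hAB
    have e' := ih (ord_eq_iff.1 e)
    rw [hC _ (by simp), hC' _ (by simp), ← add_assoc, add_right_comm, ← ord_eq_iff.2 e']
    refine hη _ ?_
    exact (ord_lt_ord_append C (by omega)).le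

/-! ### Normal forms -/

theorem nonincreasing_map_ord {n : ℕ} {L : List Word} (hS : ∀ A ∈ L, A ∈ S n) :
    L.IsChain (fun X Y => LE Y X) ↔ Nonincreasing (L.map (ord n)) := by
  have : IsTrans Word (fun X Y => ord 0 Y ≤ ord 0 X) := ⟨fun _ _ _ h h' => h'.trans h⟩
  simp only [le_iff]
  rw [List.isChain_iff_pairwise, Nonincreasing, List.pairwise_map]
  refine List.Pairwise.iff_of_mem fun hX hY => ?_
  exact ord_le_iff_of_mem_S (Nat.zero_le n) (hS _ hY) (hS _ hX)

theorem notMem_of_mem_S {n : ℕ} {A : Word} (h : A ∈ S (n + 1)) : n ∉ A := fun hn => by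
  have := h n hn
  omega

theorem mem_S_succ {n : ℕ} {A : Word} (h : A ∈ S n) (hn : n ∉ A) : A ∈ S (n + 1) :=
  fun s hs => by
    have := h s hs
    have : s ≠ n := fun e => hn (e ▸ hs)
    omega

theorem eq_nil_of_mem_S {n : ℕ} {A : Word} (h : A ∈ S n) (h' : ∀ s ∈ A, s < n + 0) : A = [] :=
  List.eq_nil_iff_forall_not_mem.2 fun s hs => absurd (h s hs) (by have := h' s hs; omega)

theorem mem_intercalate {n s : ℕ} {L : List Word} (hs : s ∈ [n].intercalate L) :
    (s = n ∧ 2 ≤ L.length) ∨ ∃ A ∈ L, s ∈ A := by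
  induction L with
  | nil => simp [List.intercalate] at hs
  | cons A L ih =>
    cases L with
    | nil => simp [List.intercalate] at hs; simp [hs]
    | cons B L =>
      simp only [List.intercalate_cons_cons, List.mem_append, List.mem_singleton] at hs
      rcases hs with (hs | rfl) | hs
      · exact Or.inr ⟨A, by simp, hs⟩
      · simp
      · rcases ih hs with ⟨rfl, -⟩ | ⟨C, hC, h⟩
        · simp
        · exact Or.inr ⟨C, by simp [hC], h⟩

theorem mem_intercalate_of_mem {n s : ℕ} {L : List Word} {A : Word} (hA : A ∈ L) (hs : s ∈ A) :
    s ∈ [n].intercalate L := by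
  simp only [List.intercalate, List.mem_flatten]
  refine ⟨A, ?_, hs⟩
  induction L with
  | nil => simp at hA
  | cons B L ih =>
    cases L with
    | nil => simpa using hA
    | cons C L =>
      rw [List.intersperse_cons_cons]
      rcases List.mem_cons.1 hA with rfl | hA
      · simp
      · simp [ih hA]

theorem oneAddOrd_intercalate {n : ℕ} {L : List Word} (hL : L ≠ []) (h : ∀ A ∈ L, n ∉ A) :
    oneAddOrd n ([n].intercalate L) = opowSum (L.map (ord (n + 1))) := by
  rw [oneAddOrd_eq, List.splitOn_intercalate n h hL]

/-- Keep the blocks of a lexicographically maximal subsequence and replace each by its normal form;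
the absorbed blocks do not affect the ordinal. -/
theorem exists_nf {r n : ℕ} {A : Word} (hA : A ∈ S n) (hA' : ∀ s ∈ A, s < n + r) :
    ∃ B, NF B ∧ B ∈ S n ∧ (∀ s ∈ B, s ∈ A) ∧ ord n B = ord n A := by
  induction r generalizing n A with
  | zero =>
    rw [eq_nil_of_mem_S hA hA']
    exact ⟨[], NF.nil, by simp [S], by simp, rfl⟩
  | succ r ih =>
    by_cases hn : n ∈ A
    · have : ∀ C ∈ A.splitOn n, ∃ B, NF B ∧ B ∈ S (n + 1) ∧ (∀ s ∈ B, s ∈ C) ∧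
          ord (n + 1) B = ord (n + 1) C := fun C hC =>
        ih (mem_S_succ (fun s hs => hA s (mem_of_mem_splitOn hC hs)) (notMem_of_mem_splitOn hC))
          fun s hs => by have := hA' s (mem_of_mem_splitOn hC hs); omega
      choose! g hg1 hg2 hg3 hg4 using this
      have hlex := lexMax_sublist ((A.splitOn n).map (ord (n + 1)))
      have hne := lexMax_ne_nil (L := (A.splitOn n).map (ord (n + 1))) (by simp)
      have hsum := opowSum_lexMax ((A.splitOn n).map (ord (n + 1)))
      have hdec := lexMax_nonincreasing ((A.splitOn n).map (ord (n + 1)))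
      obtain ⟨L, hL, e⟩ := List.sublist_map_iff.1 hlex
      rw [e] at hne hsum hdec
      have e' : (L.map g).map (ord (n + 1)) = L.map (ord (n + 1)) := by
        rw [List.map_map]
        exact List.map_congr_left fun C hC => hg4 C (hL.subset hC)
      have hgS : ∀ B ∈ L.map g, B ∈ S (n + 1) := by
        intro B hB
        obtain ⟨C, hC, rfl⟩ := List.mem_map.1 hB
        exact hg2 C (hL.subset hC)
      have hgNF : ∀ B ∈ L.map g, NF B := by
        intro B hB
        obtain ⟨C, hC, rfl⟩ := List.mem_map.1 hB
        exact hg1 C (hL.subset hC)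
      have hgA : ∀ B ∈ L.map g, ∀ s ∈ B, s ∈ A := by
        intro B hB s hs
        obtain ⟨C, hC, rfl⟩ := List.mem_map.1 hB
        exact mem_of_mem_splitOn (hL.subset hC) (hg3 C (hL.subset hC) s hs)
      have hord : ord n ([n].intercalate (L.map g)) = ord n A := by
        rw [ord_eq_iff, oneAddOrd_intercalate (by simpa using hne)
          fun B hB => notMem_of_mem_S (hgS B hB), e', hsum, oneAddOrd_eq]
      have hmem : ∀ s ∈ [n].intercalate (L.map g), s ∈ A := by
        intro s hs
        rcases mem_intercalate hs with ⟨rfl, -⟩ | ⟨B, hB, h⟩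
        · exact hn
        · exact hgA B hB s h
      refine ⟨_, ?_, fun s hs => hA s (hmem s hs), hmem, hord⟩
      by_cases hlen : 2 ≤ (L.map g).length
      · refine NF.join n _ hlen hgS ((nonincreasing_map_ord hgS).2 ?_) hgNF
        rw [e']
        exact hdec
      -- If only one block survives, then the symbol `n` disappears and the normal form is that of
      -- the block.
      · match hLg : L.map g, hlen with
        | [], _ => simp at hLg; simp [hLg] at hne
        | [B], _ =>
          rw [List.intercalate_singleton]
          exact hgNF B (by simp [hLg])
        | _ :: _ :: _, h => exact absurd (by simp) h
    · obtain ⟨B, h1, h2, h3, h4⟩ := ih (mem_S_succ hA hn) fun s hs => by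
        have := hA' s hs
        omega
      refine ⟨B, h1, fun s hs => hA s (h3 s hs), h3, ?_⟩
      rw [ord_eq_iff, oneAddOrd_of_notMem hn, oneAddOrd_of_notMem (notMem_of_mem_S h2), h4]

theorem NF.eq_intercalate {n : ℕ} {A : Word} (h : NF A) (hA : A ∈ S n) (hn : n ∈ A) :
    ∃ L : List Word, A = [n].intercalate L ∧ 2 ≤ L.length ∧ (∀ B ∈ L, B ∈ S (n + 1)) ∧
      Nonincreasing (L.map (ord (n + 1))) ∧ ∀ B ∈ L, NF B := by
  cases h with
  | nil => simp at hn
  | join m L hlen hS hmono hNF =>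
    have hm : m ∈ [m].intercalate L := by
      match L, hlen with
      | B :: C :: L, _ => simp [List.intercalate_cons_cons]
    have h1 := hA m hm
    obtain rfl : n = m := by
      rcases mem_intercalate hn with ⟨rfl, -⟩ | ⟨B, hB, h⟩
      · rfl
      · have := hS B hB n h
        omega
    exact ⟨L, rfl, hlen, hS, (nonincreasing_map_ord hS).1 hmono, hNF⟩

theorem eq_of_map_eq_map_of_injOn {β γ : Type*} {f : β → γ} {P : Set β}
    (hf : Set.InjOn f P) {X Y : List β} (hX : ∀ x ∈ X, x ∈ P) (hY : ∀ y ∈ Y, y ∈ P)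
    (h : X.map f = Y.map f) : X = Y := by
  induction X generalizing Y with
  | nil => simpa using h
  | cons x X ih => cases Y with
    | nil => simp at h
    | cons y Y =>
      simp only [List.map_cons, List.cons.injEq] at h
      rw [hf (hX x (by simp)) (hY y (by simp)) h.1,
        ih (fun z hz => hX z (by simp [hz])) (fun z hz => hY z (by simp [hz])) h.2]

theorem NF.ord_injective {r n : ℕ} {A B : Word} (hA : NF A) (hB : NF B) (hAS : A ∈ S n)
    (hBS : B ∈ S n) (hA' : ∀ s ∈ A, s < n + r) (hB' : ∀ s ∈ B, s < n + r)
    (h : ord n A = ord n B) : A = B := by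
  induction r generalizing n A B with
  | zero => rw [eq_nil_of_mem_S hAS hA', eq_nil_of_mem_S hBS hB']
  | succ r ih =>
    -- A normal form that contains `n` has a Cantor normal form with at least two terms, while a
    -- word without `n` gives a single power of `ω`.
    have mixed : ∀ {A B : Word}, NF A → A ∈ S n → n ∈ A → n ∉ B → ord n A ≠ ord n B := by
      intro A B hA hAS hn hn' h
      obtain ⟨L, rfl, hlen, hS, hdec, -⟩ := hA.eq_intercalate hAS hn
      rw [ord_eq_iff, oneAddOrd_intercalate (by rintro rfl; simp at hlen)
        fun C hC => notMem_of_mem_S (hS C hC), oneAddOrd_of_notMem hn'] at h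
      have := congrArg List.length (opowSum_injective (Y := [ord (n + 1) B]) hdec (by simp) (by simpa using h))
      simp at this
      omega
    by_cases hnA : n ∈ A <;> by_cases hnB : n ∈ B
    · obtain ⟨L, rfl, hlen, hS, hdec, hNF⟩ := hA.eq_intercalate hAS hnA
      obtain ⟨L', rfl, hlen', hS', hdec', hNF'⟩ := hB.eq_intercalate hBS hnB
      rw [ord_eq_iff, oneAddOrd_intercalate (by rintro rfl; simp at hlen)
        fun C hC => notMem_of_mem_S (hS C hC), oneAddOrd_intercalate (by rintro rfl; simp at hlen')
        fun C hC => notMem_of_mem_S (hS' C hC)] at h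
      rw [eq_of_map_eq_map_of_injOn (P := {C | NF C ∧ C ∈ S (n + 1) ∧ ∀ s ∈ C, s < n + 1 + r})
        (fun C hC D hD e => ih hC.1 hD.1 hC.2.1 hD.2.1 hC.2.2 hD.2.2 e) ?_ ?_
        (opowSum_injective hdec hdec' h)]
      · exact fun C hC => ⟨hNF C hC, hS C hC, fun s hs => by
          have := hA' s (mem_intercalate_of_mem hC hs)
          omega⟩
      · exact fun C hC => ⟨hNF' C hC, hS' C hC, fun s hs => by
          have := hB' s (mem_intercalate_of_mem hC hs)
          omega⟩
    · exact absurd h (mixed hA hAS hnA hnB)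
    · exact absurd h.symm (mixed hB hBS hnB hnA)
    · refine ih hA hB (mem_S_succ hAS hnA) (mem_S_succ hBS hnB) ?_ ?_ ?_
      · exact fun s hs => by have := hA' s hs; omega
      · exact fun s hs => by have := hB' s hs; omega
      · rw [ord_eq_iff, oneAddOrd_of_notMem hnA, oneAddOrd_of_notMem hnB] at h
        exact opow_omega_inj h

/-! ### The structure on normal forms -/

theorem exists_WN {α : ℕ∞} {A : Word} (hA : A ∈ W α) : ∃ x : WN α, ord 0 x.1 = ord 0 A := by
  obtain ⟨B, h1, -, h3, h4⟩ := exists_nf (r := A.foldr max 0 + 1) (n := 0) (A := A)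
    (fun _ _ => Nat.zero_le _) fun s hs => by have := le_foldr_max hs; omega
  exact ⟨⟨B, fun s hs => hA s (h3 s hs), h1⟩, h4⟩

theorem WN.ext_ord {α : ℕ∞} {x y : WN α} (h : ord 0 x.1 = ord 0 y.1) : x = y := by
  refine Subtype.ext (x.2.2.ord_injective (r := (x.1 ++ y.1).foldr max 0 + 1) y.2.2
    (fun _ _ => Nat.zero_le _) (fun _ _ => Nat.zero_le _) ?_ ?_ h)
  all_goals
    intro s hs
    have := le_foldr_max (A := x.1 ++ y.1) (s := s) (by simp [hs])
    omega

theorem ord_diamond {α : ℕ∞} {n : ℕ} (hn : (n : ℕ∞) ≤ α) (x : WN α) :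
    ord 0 (diamond α n x).1 = ord 0 (x.1 ++ [n]) := by
  obtain ⟨y, hy⟩ := exists_WN (α := α) (A := x.1 ++ [n]) fun s hs => by
    rcases List.mem_append.1 hs with hs | hs
    · exact x.2.1 s hs
    · rw [List.mem_singleton.1 hs]
      exact hn
  exact equiv_iff.1 (Classical.epsilon_spec (p := fun B : WN α => Equiv B.1 (x.1 ++ [n]))
    ⟨y, equiv_iff.2 hy⟩)

/-! ### Partial sums of Cantor normal forms -/

theorem opowSum_le_opow_of_lt {Z : List Ordinal.{0}} {ζ ξ : Ordinal.{0}} (hZ : ∀ z ∈ Z, z < ξ)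
    (h : ζ < ξ) : opowSum Z + ω ^ (ζ + 1) ≤ ω ^ ξ := by
  calc opowSum Z + ω ^ (ζ + 1) ≤ opowSum Z + ω ^ ξ := by
        gcongr opowSum Z + ?_
        exact opow_omega_le (Order.add_one_le_of_lt h)
    _ = ω ^ ξ := add_omega0_opow (opowSum_lt hZ)

theorem opowSum_lt_of_nonincreasing {X : List Ordinal.{0}} {ξ ζ : Ordinal.{0}}
    (hX : Nonincreasing (ξ :: X)) (h : ξ < ζ) : opowSum (ξ :: X) < ω ^ ζ :=
  opowSum_lt fun z hz => by
    rcases List.mem_cons.1 hz with rfl | hz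
    · exact h
    · exact (List.rel_of_pairwise_cons hX hz).trans_lt h

/-- Compare the leading exponents `z` of `Z` and `ξ` of `X`. Equal ones cancel, and `z > ξ` makes
the sum too large. If `z < ξ`, then either `ω ^ z` is absorbed and can be dropped, or all exponents
on the left are below `ξ` and even the sum with `ω ^ (ζ + 1)` stays `≤ ω ^ ξ`. `Z` is not assumed
nonincreasing. -/
theorem exists_take_of_le_of_lt {X Z : List Ordinal.{0}} {ζ : Ordinal.{0}} (hX : Nonincreasing X)
    (h : opowSum Z + ω ^ ζ ≤ opowSum X) (h' : opowSum X < opowSum Z + ω ^ (ζ + 1)) :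
    ∃ i < X.length, opowSum Z + ω ^ ζ = opowSum (X.take (i + 1)) := by
  induction Z generalizing X with
  | nil =>
    simp only [opowSum_nil, zero_add] at h h' ⊢
    cases X with
    | nil => exact absurd h (by simp)
    | cons ξ X =>
      rcases lt_trichotomy ζ ξ with hξ | rfl | hξ
      · have := opowSum_le_opow_of_lt (Z := []) (by simp) hξ
        simp only [opowSum_nil, zero_add] at this
        exact absurd (h'.trans_le this) (by simp)
      · exact ⟨0, by simp, by simp⟩
      · exact absurd h (opowSum_lt_of_nonincreasing hX hξ).not_ge
  | cons z Z ih =>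
    cases X with
    | nil =>
      refine absurd h (not_le.2 ?_)
      rw [opowSum_nil]
      exact (omega_opow_pos ζ).trans_le le_add_self
    | cons ξ X =>
      rcases lt_trichotomy z ξ with hξ | rfl | hξ
      · by_cases hz : ∃ y ∈ Z ++ [ζ], z < y
        · have e : opowSum (z :: Z) + ω ^ ζ = opowSum Z + ω ^ ζ := by
            obtain ⟨y, hy, hzy⟩ := hz
            simpa [add_assoc] using opowSum_absorb hy hzy
          have e' : opowSum (z :: Z) + ω ^ (ζ + 1) = opowSum Z + ω ^ (ζ + 1) := by
            have : ∃ y ∈ Z ++ [ζ + 1], z < y := by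
              obtain ⟨y, hy, hzy⟩ := hz
              rcases List.mem_append.1 hy with hy | hy
              · exact ⟨y, by simp [hy], hzy⟩
              · rw [List.mem_singleton.1 hy] at hzy
                exact ⟨ζ + 1, by simp, hzy.trans (Order.lt_add_one_iff.2 le_rfl)⟩
            obtain ⟨y, hy, hzy⟩ := this
            simpa [add_assoc] using opowSum_absorb hy hzy
          rw [e] at h ⊢
          rw [e'] at h'
          exact ih hX h h'
        · push Not at hz
          have := opowSum_le_opow_of_lt (Z := z :: Z) (ζ := ζ) (ξ := ξ) (fun y hy => by
            rcases List.mem_cons.1 hy with rfl | hy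
            · exact hξ
            · exact (hz y (by simp [hy])).trans_lt hξ) ((hz ζ (by simp)).trans_lt hξ)
          exact absurd (h'.trans_le this) (by simp)
      · rw [opowSum_cons, opowSum_cons, add_assoc] at h h'
        obtain ⟨i, hi, e⟩ := ih hX.of_cons (le_of_add_le_add_left h) (lt_of_add_lt_add_left h')
        exact ⟨i + 1, by simpa using hi, by rw [opowSum_cons, add_assoc, e]; simp⟩
      · refine absurd h (not_le.2 ((opowSum_lt_of_nonincreasing hX hξ).trans_le ?_))
        rw [opowSum_cons, add_assoc]
        exact le_self_add

/-! ### The words that code data -/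

/-- The word `3 ^ (d + i) 2 3 ^ (d + i - 1) 2 … 2 3 ^ d`. -/
def staircase : ℕ → ℕ → Word
  | 0, d => List.replicate d 3
  | i + 1, d => staircase i (d + 1) ++ 2 :: List.replicate d 3

/-- The ordinal of the word `staircase i d` without its last block. -/
noncomputable def staircaseInit : ℕ → ℕ → Ordinal.{0}
  | 0, _ => 0
  | i + 1, d => oneAddOrd 2 (staircase i (d + 1))

theorem mem_staircase {i d s : ℕ} (h : s ∈ staircase i d) : s = 2 ∨ s = 3 := by
  induction i generalizing d with
  | zero => exact Or.inr (List.eq_of_mem_replicate h)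
  | succ i ih =>
    simp only [staircase, List.mem_append, List.mem_cons] at h
    rcases h with h | h | h
    · exact ih h
    · exact Or.inl h
    · exact Or.inr (List.eq_of_mem_replicate h)

theorem ord_append_self (n : ℕ) (A : Word) : ord n (A ++ [n]) = ord n A + 1 := by
  have : oneAddOrd n (A ++ [n]) = oneAddOrd n A + 1 := by
    rw [oneAddOrd_append_cons, oneAddOrd_nil]
  rwa [oneAddOrd, oneAddOrd, add_assoc, add_right_inj] at this

theorem ord_replicate (n d : ℕ) : ord n (List.replicate d n) = d := by
  induction d with
  | zero => simp [ord_nil]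
  | succ d ih => rw [List.replicate_succ', ord_append_self, ih]; simp

theorem oneAddOrd_staircase_append (i d t : ℕ) :
    oneAddOrd 2 (staircase i d ++ List.replicate t 3) =
      staircaseInit i d + ω ^ ((d + t : ℕ) : Ordinal) := by
  cases i with
  | zero =>
    rw [staircase, List.replicate_append_replicate,
      oneAddOrd_of_notMem fun h => by simpa using List.eq_of_mem_replicate h, ord_replicate,
      staircaseInit, zero_add]
  | succ i =>
    rw [staircase, List.append_assoc, List.cons_append, List.replicate_append_replicate,
      oneAddOrd_append_cons,
      oneAddOrd_of_notMem (A := List.replicate _ 3) fun h => by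
        simpa using List.eq_of_mem_replicate h, ord_replicate,
      staircaseInit]

theorem oneAddOrd_staircase (i d : ℕ) :
    oneAddOrd 2 (staircase i d) = staircaseInit i d + ω ^ (d : Ordinal) := by
  simpa using oneAddOrd_staircase_append i d 0

theorem oneAddOrd_staircase_three (i d : ℕ) :
    oneAddOrd 2 (staircase i d ++ [3]) = staircaseInit i d + ω ^ ((d + 1 : ℕ) : Ordinal) :=
  oneAddOrd_staircase_append i d 1

/-- The last block `3 ^ (d + 2)` absorbs the block `3 ^ (d + 1)` before it, which leaves a staircase
with one step fewer. -/
theorem oneAddOrd_staircase_three_three (i d : ℕ) :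
    oneAddOrd 2 (staircase (i + 1) d ++ [3] ++ [3]) = oneAddOrd 2 (staircase i (d + 1) ++ [3]) := by
  rw [oneAddOrd_staircase_three, List.append_assoc]
  refine (oneAddOrd_staircase_append (i + 1) d 2).trans ?_
  rw [staircaseInit, oneAddOrd_staircase, add_assoc,
    add_omega0_opow (opow_omega_lt (by exact_mod_cast (by omega : d + 1 < d + 2)))]

theorem ord_staircase_append {k d : ℕ} (h : d ≤ k) :
    ord 2 (staircase k 0 ++ List.replicate (d + 1) 3) = ord 2 (staircase (k - d) d ++ [3]) := by
  induction d with
  | zero => rfl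
  | succ d ih =>
    obtain ⟨i, rfl⟩ := Nat.exists_eq_add_of_le h
    have e := ord_append_congr (m := 3) (by omega) (ih (by omega))
    rw [List.replicate_succ', ← List.append_assoc, e, ord_eq_iff]
    rw [show d + 1 + i - d = i + 1 by omega, show d + 1 + i - (d + 1) = i by omega]
    exact oneAddOrd_staircase_three_three i d

theorem add_opow_lt_add_opow {a b ε δ : Ordinal.{0}} (h : a < b + ω ^ δ) (hε : ε < δ) :
    a + ω ^ ε < b + ω ^ δ := by
  obtain ⟨d, hd, hle⟩ := (lt_add_iff (omega_opow_pos δ).ne').1 h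
  calc a + ω ^ ε ≤ b + d + ω ^ ε := by gcongr
    _ = b + (d + ω ^ ε) := add_assoc _ _ _
    _ < b + ω ^ δ := by
      gcongr
      exact isPrincipal_add_omega0_opow δ hd (opow_omega_lt hε)

/-- The right-hand word wins at the block of length `e + j`, which it lengthens by one; the blocks
that the left-hand word has after it have smaller exponents and cannot make up for this. -/
theorem oneAddOrd_staircase_lt (i j e : ℕ) :
    oneAddOrd 2 (staircase (i + j) e) < oneAddOrd 2 (staircase i (e + j) ++ [3]) := by
  induction j generalizing e with
  | zero =>
    rw [add_zero, add_zero, oneAddOrd_staircase, oneAddOrd_staircase_three]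
    gcongr staircaseInit i e + ?_
    exact opow_omega_lt (by exact_mod_cast Nat.lt_succ_self e)
  | succ j ih =>
    rw [← add_assoc, oneAddOrd_staircase, staircaseInit, oneAddOrd_staircase_three]
    have := ih (e + 1)
    rw [oneAddOrd_staircase_three, show e + 1 + j = e + (j + 1) by omega] at this
    exact add_opow_lt_add_opow this (by exact_mod_cast (by omega : e < e + (j + 1) + 1))

theorem oneAddOrd_staircase_le (i j e : ℕ) :
    oneAddOrd 2 (staircase i (e + j)) ≤ oneAddOrd 2 (staircase (i + j) e) := by
  induction j generalizing e with
  | zero => exact le_rfl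
  | succ j ih =>
    rw [← add_assoc i, oneAddOrd_staircase (i + j + 1), staircaseInit,
      show e + (j + 1) = e + 1 + j by omega]
    exact (ih (e + 1)).trans le_self_add

/-- The full staircase `staircase k 0` separates the two families: it is above every `staircase (k -
d) d` and below every raised one. So a raised staircase absorbs all unraised ones, in whatever order
the data come. -/
theorem ord_staircase_lt {k d d' : ℕ} (h : d ≤ k) (h' : d' ≤ k) :
    ord 2 (staircase (k - d) d) < ord 2 (staircase (k - d') d' ++ [3]) := by
  rw [ord_lt_iff]
  have h1 := oneAddOrd_staircase_le (k - d) d 0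
  have h2 := oneAddOrd_staircase_lt (k - d') d' 0
  rw [Nat.sub_add_cancel h, zero_add] at h1
  rw [Nat.sub_add_cancel h', zero_add] at h2
  exact h1.trans_lt h2

/-- The word that codes a finite sequence of numbers that are at most `k`. -/
def seqWord (k : ℕ) : List ℕ → Word
  | [] => []
  | d :: ds => seqWord k ds ++ 1 :: staircase (k - d) d

theorem mem_seqWord {k s : ℕ} {ds : List ℕ} (h : s ∈ seqWord k ds) : 1 ≤ s ∧ s ≤ 3 := by
  induction ds with
  | nil => simp [seqWord] at h
  | cons d ds ih =>
    simp only [seqWord, List.mem_append, List.mem_cons] at h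
    rcases h with h | h | h
    · exact ih h
    · omega
    · have := mem_staircase h
      omega

theorem one_notMem_staircase (i d : ℕ) : 1 ∉ staircase i d := fun h => by
  have := mem_staircase h
  omega

theorem oneAddOrd_seqWord_cons (k d : ℕ) (ds : List ℕ) (E : Word) (hE : 1 ∉ E) :
    oneAddOrd 1 (seqWord k (d :: ds) ++ E) =
      oneAddOrd 1 (seqWord k ds) + ω ^ ord 2 (staircase (k - d) d ++ E) := by
  rw [seqWord, List.append_assoc, List.cons_append, oneAddOrd_append_cons,
    oneAddOrd_of_notMem (A := _ ++ E) (by simp [one_notMem_staircase, hE])]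

theorem ord_seqWord_lt {k d : ℕ} {ds : List ℕ} (hds : ∀ e ∈ ds, e ≤ k) (hd : d ≤ k) :
    ord 1 (seqWord k ds) < ord 1 (staircase (k - d) d ++ [3]) := by
  rw [ord_lt_iff, oneAddOrd_of_notMem (A := _ ++ [3]) (by simp [one_notMem_staircase])]
  induction ds with
  | nil =>
    rw [seqWord, oneAddOrd_nil, ← opow_zero ω]
    exact opow_omega_lt (pos_of_gt (ord_staircase_lt hd hd))
  | cons e ds ih =>
    have := oneAddOrd_seqWord_cons k e ds [] (by simp)
    simp only [List.append_nil] at this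
    rw [this]
    exact isPrincipal_add_omega0_opow _ (ih fun x hx => hds x (by simp [hx]))
      (opow_omega_lt (ord_staircase_lt (hds e (by simp)) hd))

theorem ord_seqWord_le (k d : ℕ) (ds : List ℕ) :
    ord 1 (seqWord k ds) ≤ ord 1 (seqWord k (d :: ds)) := by
  have := oneAddOrd_seqWord_cons k d ds [] (by simp)
  simp only [List.append_nil] at this
  rw [ord_le_iff, this]
  exact le_self_add

/-- After the symbol `3` is appended, the staircase of the head `d`, which stands last in the word,
absorbs the codes of all other terms. -/
theorem ord_seqWord_append {k d : ℕ} {ds : List ℕ} (hds : ∀ e ∈ ds, e ≤ k) (hd : d ≤ k) :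
    ord 1 (seqWord k (d :: ds) ++ [3]) = ord 1 (staircase (k - d) d ++ [3]) := by
  rw [ord_eq_iff, oneAddOrd_seqWord_cons _ _ _ _ (by simp)]
  have := ord_lt_iff.1 (ord_seqWord_lt hds hd)
  rw [oneAddOrd_of_notMem (A := _ ++ [3]) (by simp [one_notMem_staircase])] at this ⊢
  exact add_omega0_opow this

theorem intercalate_append_singleton_append (n : ℕ) (L : List Word) (B E : Word) :
    [n].intercalate (L ++ [B]) ++ E = [n].intercalate (L ++ [B ++ E]) := by
  induction L with
  | nil => simp
  | cons A L ih =>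
    cases L with
    | nil => simp [List.intercalate_cons_cons]
    | cons C L =>
      simp only [List.cons_append, List.intercalate_cons_cons, List.append_assoc] at ih ⊢
      rw [ih]

/-- The word `X₀ 0 X₁ 0 … 0 X_i`, where `X_j` is the code of the sequence `ds` without its first
`j` terms. -/
def listWord (k : ℕ) (ds : List ℕ) (i : ℕ) : Word :=
  [0].intercalate ((List.range (i + 1)).map fun j => seqWord k (ds.drop j))

/-- The exponents in the ordinal of `listWord k ds i`. -/
noncomputable def listOrds (k : ℕ) (ds : List ℕ) (m : ℕ) : List Ordinal.{0} :=
  (List.range m).map fun j => ord 1 (seqWord k (ds.drop j))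

theorem mem_listWord {k s i : ℕ} {ds : List ℕ} (h : s ∈ listWord k ds i) : s ≤ 3 := by
  rcases mem_intercalate h with ⟨rfl, -⟩ | ⟨A, hA, hs⟩
  · omega
  · obtain ⟨j, -, rfl⟩ := List.mem_map.1 hA
    exact (mem_seqWord hs).2

theorem zero_notMem_seqWord (k : ℕ) (ds : List ℕ) : 0 ∉ seqWord k ds := fun h => by
  have := mem_seqWord h
  omega

theorem oneAddOrd_listWord_append (k : ℕ) (ds : List ℕ) (i : ℕ) (E : Word) (hE : 0 ∉ E) :
    oneAddOrd 0 (listWord k ds i ++ E) =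
      opowSum (listOrds k ds i) + ω ^ ord 1 (seqWord k (ds.drop i) ++ E) := by
  rw [listWord, List.range_succ, List.map_append, List.map_singleton,
    intercalate_append_singleton_append, oneAddOrd_intercalate (by simp)]
  · simp [listOrds, Function.comp_def]
  · intro A hA
    rcases List.mem_append.1 hA with hA | hA
    · obtain ⟨j, -, rfl⟩ := List.mem_map.1 hA
      exact zero_notMem_seqWord _ _
    · rw [List.mem_singleton.1 hA]
      simp [hE, zero_notMem_seqWord]

theorem listOrds_succ (k : ℕ) (ds : List ℕ) (m : ℕ) :
    listOrds k ds (m + 1) = listOrds k ds m ++ [ord 1 (seqWord k (ds.drop m))] := by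
  simp [listOrds, List.range_succ]

theorem oneAddOrd_listWord (k : ℕ) (ds : List ℕ) (i : ℕ) :
    oneAddOrd 0 (listWord k ds i) = opowSum (listOrds k ds (i + 1)) := by
  have := oneAddOrd_listWord_append k ds i [] (by simp)
  simp only [List.append_nil] at this
  rw [this, listOrds_succ]
  simp

/-- A longer suffix has more terms in its sum. Coding the terms by suffixes thus makes the exponents
at level `0` nonincreasing for arbitrary data, so that the prefixes are the partial sums of a Cantor
normal form. -/
theorem antitone_ord_seqWord_drop (k : ℕ) (ds : List ℕ) :
    Antitone fun j => ord 1 (seqWord k (ds.drop j)) := by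
  refine antitone_nat_of_succ_le fun j => ?_
  by_cases hj : j < ds.length
  · rw [List.drop_eq_getElem_cons hj]
    exact ord_seqWord_le _ _ _
  · rw [List.drop_eq_nil_of_le (by omega), List.drop_eq_nil_of_le (by omega)]

theorem listOrds_nonincreasing (k : ℕ) (ds : List ℕ) (m : ℕ) :
    Nonincreasing (listOrds k ds m) := by
  rw [listOrds, Nonincreasing, List.pairwise_map]
  exact List.pairwise_lt_range.imp fun h => antitone_ord_seqWord_drop k ds h.le

theorem take_listOrds (k : ℕ) (ds : List ℕ) {i m : ℕ} (h : i ≤ m) :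
    (listOrds k ds m).take i = listOrds k ds i := by
  rw [listOrds, ← List.map_take, List.take_range, min_eq_left h, listOrds]

/-- From place `i` on, no exponent exceeds the one at `i`, so finitely many such terms stay below
the next power of `ω`. -/
theorem opowSum_listOrds_lt (k : ℕ) (ds : List ℕ) (i j : ℕ) :
    opowSum (listOrds k ds (i + 1 + j)) <
      opowSum (listOrds k ds i) + ω ^ (ord 1 (seqWord k (ds.drop i)) + 1) := by
  induction j with
  | zero =>
    rw [add_zero, listOrds_succ]
    simp only [opowSum_append, opowSum_cons, opowSum_nil, add_zero]
    gcongr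
    exact opow_omega_lt (Order.lt_add_one_iff.2 le_rfl)
  | succ j ih =>
    rw [← add_assoc, listOrds_succ]
    simp only [opowSum_append, opowSum_cons, opowSum_nil, add_zero]
    exact add_opow_lt_add_opow ih (Order.lt_add_one_iff.2
      (antitone_ord_seqWord_drop k ds (by omega)))

theorem opowSum_listOrds_strictMono (k : ℕ) (ds : List ℕ) :
    StrictMono fun m => opowSum (listOrds k ds m) := by
  refine strictMono_nat_of_lt_succ fun m => ?_
  rw [listOrds_succ]
  simpa using omega_opow_pos _

/-! ### Coding of finite sequences in the structure -/

/-- The relation `≺` on normal forms. -/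
def WN.lt {α : ℕ∞} (x y : WN α) : Prop := LT x.1 y.1

theorem WN.lt_iff {α : ℕ∞} {x y : WN α} : x.lt y ↔ oneAddOrd 0 x.1 < oneAddOrd 0 y.1 := by
  rw [WN.lt, ReflectionWords.lt_iff, ord_lt_iff]

theorem WN.ext_oneAddOrd {α : ℕ∞} {x y : WN α} (h : oneAddOrd 0 x.1 = oneAddOrd 0 y.1) : x = y :=
  WN.ext_ord (ord_eq_iff.2 h)

theorem WN.wellFounded_lt (α : ℕ∞) : WellFounded (WN.lt (α := α)) := by
  have : WN.lt (α := α) = InvImage (· < ·) fun x : WN α => ord 0 x.1 := by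
    ext x y
    exact ReflectionWords.lt_iff
  rw [this]
  exact InvImage.wf _ _root_.wellFounded_lt

/-- `z` is a partial sum of the Cantor normal form of `b`. -/
def IsPart {α : ℕ∞} (b z : WN α) : Prop := ¬ b.lt z ∧ b.lt (diamond α 1 z)

theorem lt_diamond_three {α : ℕ∞} (hα : 3 ≤ α) (x : WN α) : x.lt (diamond α 3 x) := by
  rw [WN.lt, ReflectionWords.lt_iff, ord_diamond (by exact_mod_cast hα)]
  exact ord_lt_ord_append _ (by omega)

theorem ord_iterate_diamond {α : ℕ∞} (hα : 3 ≤ α) (x : WN α) {A : Word} (h : ord 0 x.1 = ord 0 A) (d : ℕ) :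
    ord 0 ((diamond α 3)^[d] x).1 = ord 0 (A ++ List.replicate d 3) := by
  induction d with
  | zero => simpa using h
  | succ d ih =>
    rw [Function.iterate_succ_apply', ord_diamond (by exact_mod_cast hα), List.replicate_succ',
      ← List.append_assoc]
    exact ord_append_congr (by omega) ih

/-- The symbol `1` goes to the last block at level `0`, and at level `1` it adds one to the ordinal
of this block. -/
theorem oneAddOrd_diamond_one {α : ℕ∞} (hα : 3 ≤ α) (x : WN α) : ∃ (Z : List Ordinal.{0}) (ζ : Ordinal.{0}),
    oneAddOrd 0 x.1 = opowSum Z + ω ^ ζ ∧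
    oneAddOrd 0 (diamond α 1 x).1 = opowSum Z + ω ^ (ζ + 1) := by
  obtain ⟨Z, B, -, hB⟩ := exists_lastBlock 0 x.1
  refine ⟨Z, ord 1 B, by simpa using hB [] (by simp), ?_⟩
  rw [ord_eq_iff.1 (ord_diamond (n := 1) (le_trans (by norm_num) hα) x), hB _ (by simp), zero_add,
    ord_append_self]

/-- Every finite sequence of numbers that are at most `k` is coded by an element of the
structure. -/
theorem exists_coding {α : ℕ∞} (hα : 3 ≤ α) (k : ℕ) : ∃ c : WN α, ∀ ds : List ℕ, ds ≠ [] → (∀ d ∈ ds, d ≤ k) →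
    ∃ (b : WN α) (y : ℕ → WN α), (∀ i j, i < j → (y i).lt (y j)) ∧
      (∀ z, IsPart b z ↔ ∃ i < ds.length, z = y i) ∧
      ∀ (i : ℕ) (hi : i < ds.length), diamond α 3 (y i) = (diamond α 3)^[ds[i]] c := by
  have hW : ∀ {A : Word}, (∀ s ∈ A, s ≤ 3) → A ∈ W α := fun h s hs =>
    le_trans (by exact_mod_cast h s hs) hα
  obtain ⟨c, hc⟩ := exists_WN (α := α) (A := staircase k 0 ++ [3]) (hW fun s hs => by
    rcases List.mem_append.1 hs with hs | hs
    · have := mem_staircase hs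
      omega
    · simp at hs
      omega)
  refine ⟨c, fun ds hds hk => ?_⟩
  choose y hy using fun i => exists_WN (α := α) (A := listWord k ds i) (hW fun s => mem_listWord)
  have hy' : ∀ i, oneAddOrd 0 (y i).1 = opowSum (listOrds k ds (i + 1)) := fun i => by
    rw [ord_eq_iff.1 (hy i), oneAddOrd_listWord]
  -- The code is the last of the words `listWord k ds i` in which the suffix of `ds` is still
  -- nonempty.
  obtain ⟨n, hn⟩ : ∃ n, ds.length = n + 1 := Nat.exists_eq_succ_of_ne_zero (by simpa using hds)
  refine ⟨y n, y, fun i j hij => ?_, fun z => ⟨?_, ?_⟩, fun i hi => ?_⟩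
  · rw [WN.lt_iff, hy', hy']
    exact opowSum_listOrds_strictMono k ds (by omega)
  · rintro ⟨h1, h2⟩
    rw [WN.lt_iff, not_lt, hy'] at h1
    rw [WN.lt_iff, hy'] at h2
    obtain ⟨Z, ζ, e, e'⟩ := oneAddOrd_diamond_one hα z
    rw [e] at h1
    rw [e'] at h2
    obtain ⟨i, hi, h⟩ := exists_take_of_le_of_lt (listOrds_nonincreasing k ds _) h1 h2
    rw [listOrds, List.length_map, List.length_range] at hi
    refine ⟨i, hn ▸ hi, WN.ext_oneAddOrd ?_⟩
    rw [e, h, hy', take_listOrds _ _ (by omega)]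
  · rintro ⟨i, hi, rfl⟩
    obtain ⟨j, rfl⟩ := Nat.exists_eq_add_of_le (show i ≤ n by omega)
    constructor
    · rw [WN.lt_iff, not_lt, hy', hy']
      exact (opowSum_listOrds_strictMono k ds).monotone (by omega)
    · obtain ⟨Z, ζ, e, e'⟩ := oneAddOrd_diamond_one hα (y i)
      rw [hy', listOrds_succ] at e
      simp only [opowSum_append, opowSum_cons, opowSum_nil, add_zero] at e
      -- `Z` need not be `listOrds k ds i`, but both decompositions have the same last exponent and
      -- remain equal when it is raised.
      obtain ⟨rfl, h⟩ := add_opow_eq_add_opow e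
      rw [WN.lt_iff, e', hy', ← h _ le_self_add]
      have := opowSum_listOrds_lt k ds i j
      rwa [add_right_comm] at this
  · have hd := hk _ (List.getElem_mem hi)
    have hdrop : ∀ j, ∀ e ∈ ds.drop j, e ≤ k := fun j e he => hk e (List.mem_of_mem_drop he)
    refine WN.ext_ord ?_
    rw [ord_diamond (by exact_mod_cast hα), ord_append_congr (by omega) (hy i),
      ord_iterate_diamond hα c hc, List.append_assoc]
    -- The raised staircase of `ds[i]` absorbs the staircases of the later terms at level `1`, and
    -- the codes of the longer suffixes at level `0`.
    have e1 : ord 0 (listWord k ds i ++ [3]) = ord 0 (staircase (k - ds[i]) ds[i] ++ [3]) := by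
      rw [ord_eq_iff, oneAddOrd_listWord_append _ _ _ _ (by simp), List.drop_eq_getElem_cons hi,
        ord_seqWord_append (hdrop _) hd, oneAddOrd_of_notMem]
      · refine add_omega0_opow (opowSum_lt fun ξ hξ => ?_)
        obtain ⟨j, -, rfl⟩ := List.mem_map.1 hξ
        exact ord_seqWord_lt (hdrop j) hd
      · intro h
        rcases List.mem_append.1 h with h | h
        · have := mem_staircase h
          omega
        · simp at h
    have hS : ∀ i d t, staircase i d ++ List.replicate t 3 ∈ S 2 := fun i d t s hs => by
      rcases List.mem_append.1 hs with h | h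
      · have := mem_staircase h
        omega
      · have := List.eq_of_mem_replicate h
        omega
    have e2 := ord_staircase_append hd
    rw [e1, show [3] ++ List.replicate ds[i] 3 = List.replicate (ds[i] + 1) 3 from rfl]
    -- Both words have no symbol below `2`, so the equality of their ordinals at level `2` passes to
    -- level `0`.
    refine le_antisymm ?_ ?_
    · exact (ord_le_iff_of_mem_S (Nat.zero_le 2) (hS _ _ 1) (hS _ _ _)).2 e2.ge
    · exact (ord_le_iff_of_mem_S (Nat.zero_le 2) (hS _ _ _) (hS _ _ 1)).2 e2.le

open FirstOrder

/-! ### Definable relations -/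

/-- The relation `P` on the structure `WN α` is first-order definable without parameters. -/
def IsDef {α : ℕ∞} {ι : Type} (P : (ι → WN α) → Prop) : Prop :=
  ∃ φ : Lang.Formula ι, ∀ v : ι → WN α, φ.Realize v ↔ P v

/-- The function symbol `◇1`. -/
abbrev diamondOne : Lang.Functions 1 := Func.dia1

/-- The function symbol `◇3`. -/
abbrev diamondThree : Lang.Functions 1 := Func.dia3

/-- The relation symbol `≺`. -/
abbrev precSymb : Lang.Relations 2 := Rel.prec

namespace IsDef

variable {α : ℕ∞} {ι : Type} {P Q : (ι → WN α) → Prop}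

theorem not (hP : IsDef P) : IsDef fun v => ¬ P v := by
  obtain ⟨φ, h⟩ := hP
  exact ⟨φ.not, fun v => by rw [Language.Formula.realize_not, h]⟩

theorem imp (hP : IsDef P) (hQ : IsDef Q) : IsDef fun v => P v → Q v := by
  obtain ⟨φ, h⟩ := hP
  obtain ⟨ψ, h'⟩ := hQ
  exact ⟨φ.imp ψ, fun v => by rw [Language.Formula.realize_imp, h, h']⟩

theorem and (hP : IsDef P) (hQ : IsDef Q) : IsDef fun v => P v ∧ Q v := by
  obtain ⟨φ, h⟩ := hP
  obtain ⟨ψ, h'⟩ := hQ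
  exact ⟨φ ⊓ ψ, fun v => by rw [Language.Formula.realize_inf, h, h']⟩

theorem or (hP : IsDef P) (hQ : IsDef Q) : IsDef fun v => P v ∨ Q v := by
  obtain ⟨φ, h⟩ := hP
  obtain ⟨ψ, h'⟩ := hQ
  exact ⟨φ ⊔ ψ, fun v => by rw [Language.Formula.realize_sup, h, h']⟩

theorem all {Q : (ι → WN α) → WN α → Prop}
    (h : IsDef fun w : Option ι → WN α => Q (fun i => w (some i)) (w none)) :
    IsDef fun v => ∀ x, Q v x := by
  obtain ⟨φ, h⟩ := h
  refine ⟨(Language.BoundedFormula.relabel (n := 1) (k := 0)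
    (fun o : Option ι => o.elim (Sum.inr 0) Sum.inl) φ).all, fun v => ?_⟩
  rw [Language.Formula.Realize, Language.BoundedFormula.realize_all]
  refine forall_congr' fun x => ?_
  rw [Language.BoundedFormula.realize_relabel]
  have e := h fun o : Option ι => o.elim x v
  simp only [Option.elim_none, Option.elim_some] at e
  rw [← e, Language.Formula.Realize, iff_iff_eq]
  congr 1
  · funext o
    cases o <;> rfl
  · exact Subsingleton.elim _ _

theorem ex {Q : (ι → WN α) → WN α → Prop}
    (h : IsDef fun w : Option ι → WN α => Q (fun i => w (some i)) (w none)) :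
    IsDef fun v => ∃ x, Q v x := by
  obtain ⟨φ, hφ⟩ := (all (Q := fun v x => ¬ Q v x) h.not).not
  exact ⟨φ, fun v => (hφ v).trans not_forall_not⟩

theorem eq (i j : ι) : IsDef fun v : ι → WN α => v i = v j :=
  ⟨Language.Term.equal (Language.var i) (Language.var j), fun _ =>
    Language.Formula.realize_equal⟩

theorem diamond_three_eq (i j : ι) : IsDef fun v : ι → WN α => diamond α 3 (v i) = v j :=
  ⟨Language.Term.equal (diamondThree.apply₁ (Language.var i)) (Language.var j), fun _ =>
    Language.Formula.realize_equal⟩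

theorem lt (i j : ι) : IsDef fun v : ι → WN α => (v i).lt (v j) :=
  ⟨precSymb.formula₂ (Language.var i) (Language.var j), fun _ => Iff.rfl⟩

theorem lt_diamond_one (i j : ι) : IsDef fun v : ι → WN α => (v i).lt (diamond α 1 (v j)) :=
  ⟨precSymb.formula₂ (Language.var i) (diamondOne.apply₁ (Language.var j)), fun _ => Iff.rfl⟩

theorem isPart (i j : ι) : IsDef fun v : ι → WN α => IsPart (v i) (v j) :=
  (lt _ _).not.and (lt_diamond_one _ _)

end IsDef

/-! ### Coded sequences of pairs, and relations defined by paths -/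

section Relations

variable {α : ℕ∞}

/-- Definable ternary relations. -/
def IsDef₃ (R : WN α → WN α → WN α → Prop) : Prop :=
  ∀ (ι : Type) (a b c : ι), IsDef fun v : ι → WN α => R (v a) (v b) (v c)

/-- Definable relations with four arguments. -/
def IsDef₄ (R : WN α → WN α → WN α → WN α → Prop) : Prop :=
  ∀ (ι : Type) (a b c d : ι), IsDef fun v : ι → WN α => R (v a) (v b) (v c) (v d)

/-- Definable relations with six arguments. -/
def IsDef₆ (R : WN α → WN α → WN α → WN α → WN α → WN α → Prop) : Prop :=
  ∀ (ι : Type) (a b c d e f : ι),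
    IsDef fun v : ι → WN α => R (v a) (v b) (v c) (v d) (v e) (v f)

/-- `z` is the next partial sum of `b` after `y`. -/
def IsNext (b y z : WN α) : Prop :=
  IsPart b y ∧ IsPart b z ∧ y.lt z ∧ ∀ w, IsPart b w → ¬ (y.lt w ∧ w.lt z)

theorem isDef_isNext : IsDef₃ (IsNext (α := α)) := fun _ _ _ _ =>
  (IsDef.isPart _ _).and ((IsDef.isPart _ _).and ((IsDef.lt _ _).and
    (IsDef.all ((IsDef.isPart _ _).imp ((IsDef.lt _ _).and (IsDef.lt _ _)).not))))

/-- The element `b` codes the pair `(u, v)` at the place `y`, after the mark `c`. -/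
def PairAt (c b y u v : WN α) : Prop :=
  diamond α 3 y = c ∧ ∃ y₁ y₂, IsNext b y y₁ ∧ IsNext b y₁ y₂ ∧
    diamond α 3 y₁ = u ∧ diamond α 3 y₂ = v

theorem isDef_pairAt {ι : Type} (c b y u v : ι) :
    IsDef fun w : ι → WN α => PairAt (w c) (w b) (w y) (w u) (w v) :=
  (IsDef.diamond_three_eq _ _).and (IsDef.ex (IsDef.ex ((isDef_isNext _ _ _ _).and
    ((isDef_isNext _ _ _ _).and ((IsDef.diamond_three_eq _ _).and
      (IsDef.diamond_three_eq _ _))))))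

/-- Some element codes a sequence of pairs that begins with `(a, b)`, contains `(a', b')`, and
in which every later pair is related by `R c p` to an earlier one. -/
def Path (R : WN α → WN α → WN α → WN α → WN α → WN α → Prop) (c p a b a' b' : WN α) : Prop :=
  ∃ β, (∀ y u v, PairAt c β y u v → (u = a ∧ v = b) ∨
      ∃ y' u' v', y'.lt y ∧ PairAt c β y' u' v' ∧ R c p u' v' u v) ∧
    ∃ y, PairAt c β y a' b'

theorem isDef_path {R : WN α → WN α → WN α → WN α → WN α → WN α → Prop} (hR : IsDef₆ R) :
    IsDef₆ (Path R) := fun _ _ _ _ _ _ _ =>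
  IsDef.ex ((IsDef.all (IsDef.all (IsDef.all ((isDef_pairAt _ _ _ _ _).imp
    (((IsDef.eq _ _).and (IsDef.eq _ _)).or (IsDef.ex (IsDef.ex (IsDef.ex
      ((IsDef.lt _ _).and ((isDef_pairAt _ _ _ _ _).and (hR _ _ _ _ _ _ _))))))))))).and
    (IsDef.ex (isDef_pairAt _ _ _ _ _)))

/-- Every pair in the code goes back to a pair at a smaller place, and `≺` is well founded. Nothing
is assumed of `c` or of the code, so formulas built from `Path` are correct in every context. -/
theorem Path.induction {R : WN α → WN α → WN α → WN α → WN α → WN α → Prop}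
    {c p a b a' b' : WN α} (h : Path R c p a b a' b') {I : WN α → WN α → Prop} (h0 : I a b)
    (hs : ∀ u v u' v', I u v → R c p u v u' v' → I u' v') : I a' b' := by
  obtain ⟨β, hβ, y, hy⟩ := h
  have : ∀ y u v, PairAt c β y u v → I u v := fun y => by
    induction y using (WN.wellFounded_lt α).induction with
    | _ y ih =>
      intro u v hy
      rcases hβ y u v hy with ⟨rfl, rfl⟩ | ⟨y', u', v', hlt, h', hR⟩
      · exact h0
      · exact hs _ _ _ _ (ih y' hlt u' v' h') hR
  exact this y _ _ hy

/-- The element that represents the number `j` in the context `c`. -/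
noncomputable def num (c : WN α) (j : ℕ) : WN α := (diamond α 3)^[j + 1] c

theorem diamond_num (c : WN α) (j : ℕ) : diamond α 3 (num c j) = num c (j + 1) :=
  (Function.iterate_succ_apply' _ _ _).symm

theorem diamond_self (c : WN α) : diamond α 3 c = num c 0 := rfl

/-- In the context `c`, all finite sequences of numbers that are at most `k` have codes. -/
def Codes (c : WN α) (k : ℕ) : Prop :=
  ∀ (g : ℕ → ℕ) (n : ℕ), (∀ i ≤ n, g i ≤ k) → ∃ (b : WN α) (y : ℕ → WN α),
    (∀ i j, i < j → (y i).lt (y j)) ∧ (∀ z, IsPart b z ↔ ∃ i ≤ n, z = y i) ∧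
      ∀ i ≤ n, diamond α 3 (y i) = (diamond α 3)^[g i] c

theorem exists_codes (hα : 3 ≤ α) (k : ℕ) : ∃ c : WN α, Codes c k := by
  obtain ⟨c, hc⟩ := exists_coding hα k
  refine ⟨c, fun g n hg => ?_⟩
  obtain ⟨b, y, h1, h2, h3⟩ := hc ((List.range (n + 1)).map g) (by simp) (by
    intro d hd
    obtain ⟨i, hi, rfl⟩ := List.mem_map.1 hd
    exact hg i (by simpa [Nat.lt_succ_iff] using hi))
  refine ⟨b, y, h1, fun z => ?_, fun i hi => ?_⟩
  · simp [h2 z]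
  · have := h3 i (by simpa [Nat.lt_succ_iff] using hi)
    simpa using this

theorem WN.lt_irrefl (x : WN α) : ¬ x.lt x := by simp [WN.lt_iff]

theorem WN.lt_trans {x y z : WN α} (h : x.lt y) (h' : y.lt z) : x.lt z := by
  rw [WN.lt_iff] at *
  exact h.trans h'

theorem iterate_lt_iterate (hα : 3 ≤ α) (c : WN α) {i j : ℕ} (h : i < j) :
    ((diamond α 3)^[i] c).lt ((diamond α 3)^[j] c) := by
  induction j, h using Nat.le_induction with
  | base =>
    rw [Function.iterate_succ_apply']
    exact lt_diamond_three hα _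
  | succ j _ ih =>
    rw [Function.iterate_succ_apply']
    exact WN.lt_trans ih (lt_diamond_three hα _)

theorem iterate_injective (hα : 3 ≤ α) (c : WN α) {i j : ℕ}
    (h : (diamond α 3)^[i] c = (diamond α 3)^[j] c) : i = j := by
  rcases lt_trichotomy i j with hij | hij | hij
  · have := iterate_lt_iterate hα c hij
    rw [h] at this
    exact absurd this (WN.lt_irrefl _)
  · exact hij
  · have := iterate_lt_iterate hα c hij
    rw [h] at this
    exact absurd this (WN.lt_irrefl _)

theorem num_injective (hα : 3 ≤ α) (c : WN α) {i j : ℕ} (h : num c i = num c j) : i = j := by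
  have := iterate_injective hα c h
  omega

theorem num_lt_num (hα : 3 ≤ α) (c : WN α) {i j : ℕ} : (num c i).lt (num c j) ↔ i < j := by
  refine ⟨fun h => ?_, fun h => iterate_lt_iterate hα c (by omega)⟩
  by_contra hij
  rcases (not_lt.1 hij).lt_or_eq with hij | rfl
  · exact WN.lt_irrefl _ (WN.lt_trans h (iterate_lt_iterate hα c (by omega)))
  · exact WN.lt_irrefl _ h

/-- The bounds are strict because the number `j` is coded by `j + 1`, the value `0` being reserved
for the separator. -/
theorem path_of_codes (hα : 3 ≤ α) {R : WN α → WN α → WN α → WN α → WN α → WN α → Prop}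
    {c p : WN α} {k : ℕ} (hc : Codes c k) {s : ℕ → ℕ × ℕ} {n : ℕ}
    (hk : ∀ i ≤ n, (s i).1 < k ∧ (s i).2 < k)
    (hR : ∀ i < n, R c p (num c (s i).1) (num c (s i).2)
      (num c (s (i + 1)).1) (num c (s (i + 1)).2)) :
    Path R c p (num c (s 0).1) (num c (s 0).2) (num c (s n).1) (num c (s n).2) := by
  -- Each pair takes three places: a separator and the two components, shifted by one.
  let g : ℕ → ℕ := fun i =>
    if i % 3 = 0 then 0 else if i % 3 = 1 then (s (i / 3)).1 + 1 else (s (i / 3)).2 + 1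
  have g0 : ∀ i, g (3 * i) = 0 := fun i => by simp [g]
  have g1 : ∀ i, g (3 * i + 1) = (s i).1 + 1 := fun i => by
    have h1 : (3 * i + 1) % 3 = 1 := by omega
    have h2 : (3 * i + 1) / 3 = i := by omega
    simp [g, h1, h2]
  have g2 : ∀ i, g (3 * i + 2) = (s i).2 + 1 := fun i => by
    have h1 : (3 * i + 2) % 3 = 2 := by omega
    have h2 : (3 * i + 2) / 3 = i := by omega
    simp [g, h1, h2]
  obtain ⟨b, y, hy, hb, hf⟩ := hc g (3 * n + 2) fun i hi => by
    have := hk (i / 3) (by omega)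
    simp only [g]
    split_ifs <;> omega
  have hlt : ∀ i j, (y i).lt (y j) → i < j := by
    intro i j h
    by_contra hij
    rcases (not_lt.1 hij).lt_or_eq with hij | rfl
    · exact WN.lt_irrefl _ (WN.lt_trans h (hy _ _ hij))
    · exact WN.lt_irrefl _ h
  have next : ∀ i, i + 1 ≤ 3 * n + 2 → IsNext b (y i) (y (i + 1)) := by
    refine fun i hi => ⟨(hb _).2 ⟨i, by omega, rfl⟩, (hb _).2 ⟨i + 1, hi, rfl⟩,
      hy _ _ (by omega), fun w hw => ?_⟩
    obtain ⟨j, -, rfl⟩ := (hb w).1 hw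
    rintro ⟨h1, h2⟩
    have := hlt _ _ h1
    have := hlt _ _ h2
    omega
  have of_next : ∀ i z, IsNext b (y i) z → i + 1 ≤ 3 * n + 2 ∧ z = y (i + 1) := by
    rintro i z ⟨-, h2, h3, h4⟩
    obtain ⟨j, hj, rfl⟩ := (hb z).1 h2
    have hij := hlt _ _ h3
    rcases (Nat.succ_le_of_lt hij).eq_or_lt with rfl | hj'
    · exact ⟨hj, rfl⟩
    · exact absurd ⟨hy _ _ (by omega), hy _ _ hj'⟩
        (h4 (y (i + 1)) ((hb _).2 ⟨i + 1, by omega, rfl⟩))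
  have pair : ∀ i ≤ n, PairAt c b (y (3 * i)) (num c (s i).1) (num c (s i).2) := by
    refine fun i hi => ⟨?_, y (3 * i + 1), y (3 * i + 2), next _ (by omega), next _ (by omega),
      ?_, ?_⟩
    · rw [hf _ (by omega), g0]
      rfl
    · rw [hf _ (by omega), g1]
      rfl
    · rw [hf _ (by omega), g2]
      rfl
  have of_pair : ∀ z u v, PairAt c b z u v →
      ∃ i ≤ n, z = y (3 * i) ∧ u = num c (s i).1 ∧ v = num c (s i).2 := by
    rintro z u v ⟨h0, y₁, y₂, h1, h2, rfl, rfl⟩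
    obtain ⟨j, hj, rfl⟩ := (hb z).1 h1.1
    rw [hf j hj] at h0
    -- Only separators have the value `0`, so the place of a pair is a multiple of `3`.
    have hg := iterate_injective hα c (j := 0) h0
    have hj3 : j % 3 = 0 := by
      by_contra h
      simp only [g, h, if_false] at hg
      split_ifs at hg
    obtain ⟨i, rfl⟩ := Nat.dvd_of_mod_eq_zero hj3
    obtain ⟨h3, rfl⟩ := of_next _ _ h1
    obtain ⟨h4, rfl⟩ := of_next _ _ h2
    refine ⟨i, by omega, rfl, ?_, ?_⟩
    · rw [hf _ h3, g1]
      rfl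
    · rw [hf _ h4, g2]
      rfl
  refine ⟨b, fun z u v h => ?_, y (3 * n), pair n le_rfl⟩
  obtain ⟨i, hi, rfl, rfl, rfl⟩ := of_pair z u v h
  cases i with
  | zero => exact Or.inl ⟨rfl, rfl⟩
  | succ i =>
    exact Or.inr ⟨y (3 * i), _, _, hy _ _ (by omega), pair i (by omega), hR i (by omega)⟩

/-- A path of fixed length involves finitely many steps and numbers, so all large `k` serve at once.
-/
theorem eventually_path (hα : 3 ≤ α) {R : WN α → WN α → WN α → WN α → WN α → WN α → Prop}
    {ctx : ℕ → WN α} (hctx : ∀ k, Codes (ctx k) k) (p : ℕ → WN α) (s : ℕ → ℕ × ℕ) (n : ℕ)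
    (hR : ∀ i < n, ∀ᶠ k in atTop, R (ctx k) (p k) (num (ctx k) (s i).1) (num (ctx k) (s i).2)
      (num (ctx k) (s (i + 1)).1) (num (ctx k) (s (i + 1)).2)) :
    ∀ᶠ k in atTop, Path R (ctx k) (p k) (num (ctx k) (s 0).1) (num (ctx k) (s 0).2)
      (num (ctx k) (s n).1) (num (ctx k) (s n).2) := by
  have h1 : ∀ᶠ k in atTop, ∀ i ∈ Finset.range n, R (ctx k) (p k) (num (ctx k) (s i).1)
      (num (ctx k) (s i).2) (num (ctx k) (s (i + 1)).1) (num (ctx k) (s (i + 1)).2) :=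
    (Filter.eventually_all_finset _).2 fun i hi => hR i (Finset.mem_range.1 hi)
  have h2 : ∀ᶠ k in atTop, ∀ i ∈ Finset.range (n + 1), (s i).1 < k ∧ (s i).2 < k :=
    (Filter.eventually_all_finset _).2 fun i _ =>
      (eventually_gt_atTop _).and (eventually_gt_atTop _)
  filter_upwards [h1, h2] with k h1 h2
  exact path_of_codes hα (hctx k) (fun i hi => h2 i (Finset.mem_range.2 (by omega)))
    fun i hi => h1 i (Finset.mem_range.2 hi)

end Relations

/-! ### Addition, multiplication and pairing, correct in every context -/

section Arithmetic

variable {α : ℕ∞}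

/-- Both components of a pair of numbers increase by one. -/
def SuccStep (_ _ u v u' v' : WN α) : Prop := diamond α 3 u = u' ∧ diamond α 3 v = v'

theorem isDef_succStep : IsDef₆ (SuccStep (α := α)) := fun _ _ _ _ _ _ _ =>
  (IsDef.diamond_three_eq _ _).and (IsDef.diamond_three_eq _ _)

/-- `x` is a number. -/
def NumRel (c x : WN α) : Prop := ∃ o, diamond α 3 c = o ∧ Path SuccStep c c o o x x

theorem isDef_numRel {ι : Type} (c x : ι) : IsDef fun v : ι → WN α => NumRel (v c) (v x) :=
  IsDef.ex ((IsDef.diamond_three_eq _ _).and (isDef_path isDef_succStep _ _ _ _ _ _ _))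

/-- `x + y = z`. -/
def AddRel (c x y z : WN α) : Prop := ∃ o, diamond α 3 c = o ∧ Path SuccStep c c o x y z

theorem isDef_addRel : IsDef₄ (AddRel (α := α)) := fun _ _ _ _ _ =>
  IsDef.ex ((IsDef.diamond_three_eq _ _).and (isDef_path isDef_succStep _ _ _ _ _ _ _))

/-- The first component increases by one, the second one by `p`. -/
def AddStep (c p u v u' v' : WN α) : Prop := diamond α 3 u = u' ∧ AddRel c v p v'

theorem isDef_addStep : IsDef₆ (AddStep (α := α)) := fun _ _ _ _ _ _ _ =>
  (IsDef.diamond_three_eq _ _).and (isDef_addRel _ _ _ _ _)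

/-- `x * y = z`. -/
def MulRel (c x y z : WN α) : Prop := ∃ o, diamond α 3 c = o ∧ Path AddStep c x o o y z

theorem isDef_mulRel : IsDef₄ (MulRel (α := α)) := fun _ _ _ _ _ =>
  IsDef.ex ((IsDef.diamond_three_eq _ _).and (isDef_path isDef_addStep _ _ _ _ _ _ _))

/-- `z` is the code `Nat.pair x y` of the pair `(x, y)`. -/
def PairRel (c x y z : WN α) : Prop :=
  (x.lt y ∧ ∃ s, MulRel c y y s ∧ AddRel c s x z) ∨
    (¬ x.lt y ∧ ∃ s, MulRel c x x s ∧ ∃ t, AddRel c s x t ∧ AddRel c t y z)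

theorem isDef_pairRel : IsDef₄ (PairRel (α := α)) := fun _ _ _ _ _ =>
  ((IsDef.lt _ _).and (IsDef.ex ((isDef_mulRel _ _ _ _ _).and (isDef_addRel _ _ _ _ _)))).or
    ((IsDef.lt _ _).not.and (IsDef.ex ((isDef_mulRel _ _ _ _ _).and
      (IsDef.ex ((isDef_addRel _ _ _ _ _).and (isDef_addRel _ _ _ _ _))))))

theorem NumRel.exists_eq_num {c x : WN α} (h : NumRel c x) : ∃ i, x = num c i := by
  obtain ⟨o, rfl, h⟩ := h
  refine h.induction (I := fun u _ => ∃ i, u = num c i) ⟨0, rfl⟩ ?_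
  rintro _ v _ _ ⟨i, rfl⟩ ⟨rfl, -⟩
  exact ⟨i + 1, diamond_num c i⟩

/-- The path invariant is that the pair is `(t, i + t)`; injectivity of `num` identifies the final
`t` with `j`. That `z` is a number at all is part of what is proved. -/
theorem AddRel.eq_num (hα : 3 ≤ α) {c z : WN α} {i j : ℕ}
    (h : AddRel c (num c i) (num c j) z) : z = num c (i + j) := by
  obtain ⟨o, rfl, h⟩ := h
  obtain ⟨t, ht, rfl⟩ := h.induction (I := fun u v => ∃ t, u = num c t ∧ v = num c (i + t))
    ⟨0, rfl, rfl⟩ (by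
      rintro _ _ _ _ ⟨t, rfl, rfl⟩ ⟨rfl, rfl⟩
      exact ⟨t + 1, diamond_num c t, diamond_num c (i + t)⟩)
  rw [num_injective hα c ht]

theorem MulRel.eq_num (hα : 3 ≤ α) {c z : WN α} {i j : ℕ}
    (h : MulRel c (num c i) (num c j) z) : z = num c (i * j) := by
  obtain ⟨o, rfl, h⟩ := h
  obtain ⟨t, ht, rfl⟩ := h.induction (I := fun u v => ∃ t, u = num c t ∧ v = num c (i * t))
    ⟨0, rfl, rfl⟩ (by
      rintro _ _ _ _ ⟨t, rfl, rfl⟩ ⟨rfl, h⟩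
      exact ⟨t + 1, diamond_num c t, h.eq_num hα⟩)
  rw [num_injective hα c ht]

theorem PairRel.eq_num (hα : 3 ≤ α) {c z : WN α} {i j : ℕ}
    (h : PairRel c (num c i) (num c j) z) : z = num c (Nat.pair i j) := by
  rw [PairRel, num_lt_num hα] at h
  rw [Nat.pair]
  rcases h with ⟨hij, s, hs, h⟩ | ⟨hij, s, hs, t, ht, h⟩
  · obtain rfl := hs.eq_num hα
    rw [if_pos hij, h.eq_num hα]
  · obtain rfl := hs.eq_num hα
    obtain rfl := ht.eq_num hα
    rw [if_neg hij, h.eq_num hα]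

/-! ### True arithmetical facts hold in all large contexts -/

variable {ctx : ℕ → WN α}

theorem eventually_numRel (hα : 3 ≤ α) (hctx : ∀ k, Codes (ctx k) k) (i : ℕ) :
    ∀ᶠ k in atTop, NumRel (ctx k) (num (ctx k) i) :=
  (eventually_path hα hctx ctx (fun t => (t, t)) i fun _ _ => Eventually.of_forall fun _ =>
    ⟨diamond_num _ _, diamond_num _ _⟩).mono fun _ h => ⟨_, rfl, h⟩

theorem eventually_addRel (hα : 3 ≤ α) (hctx : ∀ k, Codes (ctx k) k) (i j : ℕ) :
    ∀ᶠ k in atTop, AddRel (ctx k) (num (ctx k) i) (num (ctx k) j) (num (ctx k) (i + j)) :=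
  (eventually_path hα hctx ctx (fun t => (t, i + t)) j fun _ _ => Eventually.of_forall fun _ =>
    ⟨diamond_num _ _, diamond_num _ _⟩).mono fun _ h => ⟨_, rfl, h⟩

theorem eventually_mulRel (hα : 3 ≤ α) (hctx : ∀ k, Codes (ctx k) k) (i j : ℕ) :
    ∀ᶠ k in atTop, MulRel (ctx k) (num (ctx k) i) (num (ctx k) j) (num (ctx k) (i * j)) :=
  (eventually_path (R := AddStep) hα hctx (fun k => num (ctx k) i) (fun t => (t, i * t)) j
    fun t _ => (eventually_addRel hα hctx (i * t) i).mono fun _ h =>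
      ⟨diamond_num _ _, h⟩).mono fun _ h => ⟨_, rfl, h⟩

theorem eventually_pairRel (hα : 3 ≤ α) (hctx : ∀ k, Codes (ctx k) k) (i j : ℕ) :
    ∀ᶠ k in atTop,
      PairRel (ctx k) (num (ctx k) i) (num (ctx k) j) (num (ctx k) (Nat.pair i j)) := by
  simp only [PairRel, num_lt_num hα, Nat.pair]
  split_ifs with hij
  · filter_upwards [eventually_mulRel hα hctx j j, eventually_addRel hα hctx (j * j) i]
      with k h1 h2
    exact Or.inl ⟨hij, _, h1, h2⟩
  · filter_upwards [eventually_mulRel hα hctx i i, eventually_addRel hα hctx (i * i) i,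
      eventually_addRel hα hctx (i * i + i) j] with k h1 h2 h3
    exact Or.inr ⟨hij, _, h1, _, h2, h3⟩

/-- The definable relation `R` represents the partial function `F`. -/
structure Represents (ctx : ℕ → WN α) (R : WN α → WN α → WN α → Prop) (F : ℕ →. ℕ) : Prop where
  isDef : IsDef₃ R
  sound : ∀ {c : WN α} {i : ℕ} {y : WN α}, R c (num c i) y → ∃ j ∈ F i, y = num c j
  complete : ∀ {i j : ℕ}, j ∈ F i →
    ∀ᶠ k in atTop, R (ctx k) (num (ctx k) i) (num (ctx k) j)

theorem exists_represents_zero : ∃ R, Represents ctx R (pure 0) :=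
  ⟨fun c _ y => diamond α 3 c = y,
    fun _ _ _ _ => IsDef.diamond_three_eq _ _,
    fun h => ⟨0, Part.mem_some 0, h.symm⟩,
    fun h => by
      obtain rfl := Part.mem_some_iff.1 h
      exact Eventually.of_forall fun _ => rfl⟩

theorem exists_represents_succ : ∃ R, Represents ctx R Nat.succ :=
  ⟨fun _ x y => diamond α 3 x = y,
    fun _ _ _ _ => IsDef.diamond_three_eq _ _,
    fun h => ⟨_, Part.mem_some _, h.symm.trans (diamond_num _ _)⟩,
    fun h => by
      obtain rfl := Part.mem_some_iff.1 h
      exact Eventually.of_forall fun _ => diamond_num _ _⟩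

theorem exists_represents_left (hα : 3 ≤ α) (hctx : ∀ k, Codes (ctx k) k) :
    ∃ R, Represents ctx R (fun n : ℕ => n.unpair.1 : ℕ → ℕ) := by
  refine ⟨fun c x y => NumRel c y ∧ ∃ z, NumRel c z ∧ PairRel c y z x,
    fun _ _ _ _ => (isDef_numRel _ _).and (IsDef.ex ((isDef_numRel _ _).and
      (isDef_pairRel _ _ _ _ _))), ?_, ?_⟩
  · rintro c i y ⟨h1, z, h2, h3⟩
    obtain ⟨a, rfl⟩ := h1.exists_eq_num
    obtain ⟨b, rfl⟩ := h2.exists_eq_num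
    obtain rfl := num_injective hα c (h3.eq_num hα)
    exact ⟨a, by simp, rfl⟩
  · intro i j h
    obtain rfl := Part.mem_some_iff.1 h
    filter_upwards [eventually_numRel hα hctx i.unpair.1, eventually_numRel hα hctx i.unpair.2,
      eventually_pairRel hα hctx i.unpair.1 i.unpair.2] with k h1 h2 h3
    rw [Nat.pair_unpair] at h3
    exact ⟨h1, _, h2, h3⟩

theorem exists_represents_right (hα : 3 ≤ α) (hctx : ∀ k, Codes (ctx k) k) :
    ∃ R, Represents ctx R (fun n : ℕ => n.unpair.2 : ℕ → ℕ) := by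
  refine ⟨fun c x y => NumRel c y ∧ ∃ z, NumRel c z ∧ PairRel c z y x,
    fun _ _ _ _ => (isDef_numRel _ _).and (IsDef.ex ((isDef_numRel _ _).and
      (isDef_pairRel _ _ _ _ _))), ?_, ?_⟩
  · rintro c i y ⟨h1, z, h2, h3⟩
    obtain ⟨a, rfl⟩ := h1.exists_eq_num
    obtain ⟨b, rfl⟩ := h2.exists_eq_num
    obtain rfl := num_injective hα c (h3.eq_num hα)
    exact ⟨a, by simp, rfl⟩
  · intro i j h
    obtain rfl := Part.mem_some_iff.1 h
    filter_upwards [eventually_numRel hα hctx i.unpair.1, eventually_numRel hα hctx i.unpair.2,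
      eventually_pairRel hα hctx i.unpair.1 i.unpair.2] with k h1 h2 h3
    rw [Nat.pair_unpair] at h3
    exact ⟨h2, _, h1, h3⟩

/-! ### Closure of representability under the operations on partial functions -/

variable {F G : ℕ →. ℕ} {R T : WN α → WN α → WN α → Prop}

theorem Represents.exists_pair (hα : 3 ≤ α) (hctx : ∀ k, Codes (ctx k) k)
    (hF : Represents ctx R F) (hG : Represents ctx T G) :
    ∃ U, Represents ctx U fun n => Nat.pair <$> F n <*> G n := by
  refine ⟨fun c x y => ∃ u v, R c x u ∧ T c x v ∧ PairRel c u v y,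
    fun _ _ _ _ => IsDef.ex (IsDef.ex ((hF.isDef _ _ _ _).and ((hG.isDef _ _ _ _).and
      (isDef_pairRel _ _ _ _ _)))), ?_, ?_⟩
  · rintro c i y ⟨u, v, h1, h2, h3⟩
    obtain ⟨a, ha, rfl⟩ := hF.sound h1
    obtain ⟨b, hb, rfl⟩ := hG.sound h2
    refine ⟨_, ?_, h3.eq_num hα⟩
    simp only [Seq.seq, Part.map_eq_map, Part.mem_bind_iff, Part.mem_map_iff]
    exact ⟨_, ⟨a, ha, rfl⟩, b, hb, rfl⟩
  · intro i j h
    simp only [Seq.seq, Part.map_eq_map, Part.mem_bind_iff, Part.mem_map_iff] at h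
    obtain ⟨_, ⟨a, ha, rfl⟩, b, hb, rfl⟩ := h
    filter_upwards [hF.complete ha, hG.complete hb, eventually_pairRel hα hctx a b]
      with k h1 h2 h3
    exact ⟨_, _, h1, h2, h3⟩

theorem Represents.exists_comp (hF : Represents ctx R F) (hG : Represents ctx T G) :
    ∃ U, Represents ctx U fun n => G n >>= F := by
  refine ⟨fun c x y => ∃ u, T c x u ∧ R c u y,
    fun _ _ _ _ => IsDef.ex ((hG.isDef _ _ _ _).and (hF.isDef _ _ _ _)), ?_, ?_⟩
  · rintro c i y ⟨u, h1, h2⟩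
    obtain ⟨a, ha, rfl⟩ := hG.sound h1
    obtain ⟨b, hb, rfl⟩ := hF.sound h2
    exact ⟨b, Part.mem_bind_iff.2 ⟨a, ha, hb⟩, rfl⟩
  · intro i j h
    obtain ⟨a, ha, hj⟩ := Part.mem_bind_iff.1 h
    filter_upwards [hG.complete ha, hF.complete hj] with k h1 h2
    exact ⟨_, h1, h2⟩

/-- The value of a function that is defined by primitive recursion. -/
def precValue (F G : ℕ →. ℕ) (a n : ℕ) : Part ℕ :=
  n.rec (F a) fun y IH => do let i ← IH; G (Nat.pair a (Nat.pair y i))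

theorem precValue_zero (a : ℕ) : precValue F G a 0 = F a := rfl

theorem mem_precValue_succ {a n v : ℕ} : v ∈ precValue F G a (n + 1) ↔
    ∃ u ∈ precValue F G a n, v ∈ G (Nat.pair a (Nat.pair n u)) :=
  Part.mem_bind_iff

theorem exists_precValue_sequence {a n j : ℕ} (h : j ∈ precValue F G a n) :
    ∃ w : ℕ → ℕ, w n = j ∧ w 0 ∈ F a ∧ ∀ i < n, w (i + 1) ∈ G (Nat.pair a (Nat.pair i (w i))) := by
  induction n generalizing j with
  | zero => exact ⟨fun _ => j, rfl, h, by simp⟩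
  | succ n ih =>
    obtain ⟨u, hu, hj⟩ := mem_precValue_succ.1 h
    obtain ⟨w, rfl, h0, hs⟩ := ih hu
    refine ⟨fun i => if i ≤ n then w i else j, by simp, by simpa using h0, fun i hi => ?_⟩
    rcases (Nat.lt_succ_iff.1 hi).lt_or_eq with hi' | rfl
    · simpa [hi'.le, Nat.succ_le_of_lt hi'] using hs i hi'
    · simpa using hj

/-- The step of a primitive recursion. -/
def PrecStep (T : WN α → WN α → WN α → Prop) (c p u v u' v' : WN α) : Prop :=
  diamond α 3 u = u' ∧ ∃ s t, PairRel c u v s ∧ PairRel c p s t ∧ T c t v'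

theorem isDef_precStep (hT : IsDef₃ T) : IsDef₆ (PrecStep T) := fun _ _ _ _ _ _ _ =>
  (IsDef.diamond_three_eq _ _).and (IsDef.ex (IsDef.ex ((isDef_pairRel _ _ _ _ _).and
    ((isDef_pairRel _ _ _ _ _).and (hT _ _ _ _)))))

/-- The path runs through the pairs `(m, value at m)`, starting from the value of `F`; its parameter
is the fixed argument `a`. -/
theorem Represents.exists_prec (hα : 3 ≤ α) (hctx : ∀ k, Codes (ctx k) k)
    (hF : Represents ctx R F) (hG : Represents ctx T G) :
    ∃ U, Represents ctx U (Nat.unpaired fun a n => precValue F G a n) := by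
  refine ⟨fun c x y => ∃ a n, NumRel c a ∧ NumRel c n ∧ PairRel c a n x ∧
    ∃ v o, R c a v ∧ diamond α 3 c = o ∧ Path (PrecStep T) c a o v n y,
    fun _ _ _ _ => IsDef.ex (IsDef.ex ((isDef_numRel _ _).and ((isDef_numRel _ _).and
      ((isDef_pairRel _ _ _ _ _).and (IsDef.ex (IsDef.ex ((hF.isDef _ _ _ _).and
        ((IsDef.diamond_three_eq _ _).and
          (isDef_path (isDef_precStep hG.isDef) _ _ _ _ _ _ _))))))))), ?_, ?_⟩
  · rintro c i y ⟨a, n, ha, hn, hi, v, o, hv, rfl, h⟩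
    obtain ⟨a, rfl⟩ := ha.exists_eq_num
    obtain ⟨n, rfl⟩ := hn.exists_eq_num
    obtain rfl := num_injective hα c (hi.eq_num hα)
    obtain ⟨v, hv, rfl⟩ := hF.sound hv
    obtain ⟨m, j, hm, rfl, hj⟩ := h.induction
      (I := fun u v => ∃ m j, u = num c m ∧ v = num c j ∧ j ∈ precValue F G a m)
      ⟨0, v, rfl, rfl, by rwa [precValue_zero]⟩ (by
        rintro _ _ _ v' ⟨m, j, rfl, rfl, hj⟩ ⟨rfl, s, t, h1, h2, h3⟩
        obtain rfl := h1.eq_num hα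
        obtain rfl := h2.eq_num hα
        obtain ⟨j', hj', rfl⟩ := hG.sound h3
        exact ⟨m + 1, j', diamond_num _ _, rfl, mem_precValue_succ.2 ⟨j, hj, hj'⟩⟩)
    obtain rfl := num_injective hα c hm
    exact ⟨j, by simpa [Nat.unpaired] using hj, rfl⟩
  · intro i j h
    obtain ⟨w, rfl, h0, hs⟩ := exists_precValue_sequence h
    have hpath := eventually_path (R := PrecStep T) hα hctx (fun k => num (ctx k) i.unpair.1)
      (fun t => (t, w t)) i.unpair.2 fun t ht => by
        filter_upwards [eventually_pairRel hα hctx t (w t),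
          eventually_pairRel hα hctx i.unpair.1 (Nat.pair t (w t)), hG.complete (hs t ht)]
          with k h1 h2 h3
        exact ⟨diamond_num _ _, _, _, h1, h2, h3⟩
    filter_upwards [hpath, hF.complete h0, eventually_numRel hα hctx i.unpair.1,
      eventually_numRel hα hctx i.unpair.2,
      eventually_pairRel hα hctx i.unpair.1 i.unpair.2] with k h1 h2 h3 h4 h5
    rw [Nat.pair_unpair] at h5
    exact ⟨_, _, h3, h4, h5, _, _, h2, rfl, h1⟩

/-- The step of an unbounded search for a zero. -/
def RfindStep (R : WN α → WN α → WN α → Prop) (c p u v u' v' : WN α) : Prop :=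
  SuccStep c p u v u' v' ∧ ∃ t w, PairRel c p u t ∧ R c t w ∧ ¬ diamond α 3 c = w

theorem isDef_rfindStep (hR : IsDef₃ R) : IsDef₆ (RfindStep R) := fun _ _ _ _ _ _ _ =>
  (isDef_succStep _ _ _ _ _ _ _).and (IsDef.ex (IsDef.ex ((isDef_pairRel _ _ _ _ _).and
    ((hR _ _ _ _).and (IsDef.diamond_three_eq _ _).not))))

theorem mem_rfind_iff {a n : ℕ} :
    n ∈ Nat.rfind (fun n => (fun m => decide (m = 0)) <$> F (Nat.pair a n)) ↔
      0 ∈ F (Nat.pair a n) ∧ ∀ m < n, ∃ v ∈ F (Nat.pair a m), v ≠ 0 := by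
  refine Nat.mem_rfind.trans ?_
  simp only [Part.map_eq_map, Part.mem_map_iff, decide_eq_true_eq, decide_eq_false_iff_not,
    exists_eq_right, ne_eq]

/-- The path counts upwards and may leave `m` only when a nonzero value at `m` is certified.
Reaching `y` thus shows that all smaller values are defined and nonzero. -/
theorem Represents.exists_rfind (hα : 3 ≤ α) (hctx : ∀ k, Codes (ctx k) k)
    (hF : Represents ctx R F) : ∃ U, Represents ctx U fun a =>
      Nat.rfind fun n => (fun m => decide (m = 0)) <$> F (Nat.pair a n) := by
  refine ⟨fun c x y => ∃ o, diamond α 3 c = o ∧ Path (RfindStep R) c x o o y y ∧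
    ∃ t, PairRel c x y t ∧ R c t o,
    fun _ _ _ _ => IsDef.ex ((IsDef.diamond_three_eq _ _).and
      ((isDef_path (isDef_rfindStep hF.isDef) _ _ _ _ _ _ _).and
        (IsDef.ex ((isDef_pairRel _ _ _ _ _).and (hF.isDef _ _ _ _))))), ?_, ?_⟩
  · rintro c a y ⟨o, rfl, h, t, ht, h0⟩
    obtain ⟨n, rfl, hn⟩ := h.induction (I := fun u _ => ∃ n, u = num c n ∧
        ∀ m < n, ∃ v ∈ F (Nat.pair a m), v ≠ 0)
      ⟨0, rfl, by simp⟩ (by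
        rintro _ _ _ _ ⟨n, rfl, hn⟩ ⟨⟨rfl, -⟩, t, w, h1, h2, h3⟩
        obtain rfl := h1.eq_num hα
        obtain ⟨v, hv, rfl⟩ := hF.sound h2
        refine ⟨n + 1, diamond_num _ _, fun m hm => ?_⟩
        rcases (Nat.lt_succ_iff.1 hm).lt_or_eq with hm | rfl
        · exact hn m hm
        · refine ⟨v, hv, ?_⟩
          rintro rfl
          exact h3 rfl)
    obtain rfl := ht.eq_num hα
    -- The number `0` is represented by `◇3 c`, so the value found at `n` is `0`.
    obtain ⟨v, hv, e⟩ := hF.sound h0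
    obtain rfl := num_injective hα c ((diamond_self c).symm.trans e)
    exact ⟨n, mem_rfind_iff.2 ⟨hv, hn⟩, rfl⟩
  · intro a n h
    obtain ⟨h0, hn⟩ := mem_rfind_iff.1 h
    have hpath := eventually_path (R := RfindStep R) hα hctx (fun k => num (ctx k) a)
      (fun t => (t, t)) n fun m hm => by
        obtain ⟨v, hv, hv0⟩ := hn m hm
        filter_upwards [eventually_pairRel hα hctx a m, hF.complete hv] with k h1 h2
        exact ⟨⟨diamond_num _ _, diamond_num _ _⟩, _, _, h1, h2,
          fun e => hv0 (num_injective hα _ ((diamond_self _).symm.trans e)).symm⟩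
    filter_upwards [hpath, eventually_pairRel hα hctx a n, hF.complete h0] with k h1 h2 h3
    exact ⟨_, rfl, h1, _, h2, h3⟩

theorem exists_represents (hα : 3 ≤ α) (hctx : ∀ k, Codes (ctx k) k) (hF : Nat.Partrec F) :
    ∃ R, Represents ctx R F := by
  induction hF with
  | zero => exact exists_represents_zero
  | succ => exact exists_represents_succ
  | left => exact exists_represents_left hα hctx
  | right => exact exists_represents_right hα hctx
  | pair _ _ ihF ihG =>
    obtain ⟨R, hR⟩ := ihF
    obtain ⟨T, hT⟩ := ihG
    exact hR.exists_pair hα hctx hT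
  | comp _ _ ihF ihG =>
    obtain ⟨R, hR⟩ := ihF
    obtain ⟨T, hT⟩ := ihG
    exact hR.exists_comp hT
  | prec _ _ ihF ihG =>
    obtain ⟨R, hR⟩ := ihF
    obtain ⟨T, hT⟩ := ihG
    exact hR.exists_prec hα hctx hT
  | rfind _ ihF =>
    obtain ⟨R, hR⟩ := ihF
    exact hR.exists_rfind hα hctx

end Arithmetic

/-! ### The reduction of the halting problem -/

/-- The term `◇3 … ◇3 x₀` with `n` function symbols. -/
def iterTerm (n : ℕ) : Lang.Term (Empty ⊕ Fin 2) :=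
  (fun t => diamondThree.apply₁ t)^[n] (Language.var (Sum.inr 0))

theorem termCode_iterTerm (n : ℕ) :
    termCode (iterTerm n) = (fun m => Nat.pair 2 m)^[n] (Nat.pair 0 0) := by
  induction n with
  | zero => rfl
  | succ n ih =>
    rw [Function.iterate_succ_apply', ← ih, iterTerm, Function.iterate_succ_apply']
    rfl

theorem realize_iterTerm {α : ℕ∞} (n : ℕ) (v : Empty ⊕ Fin 2 → WN α) :
    (iterTerm n).realize v = (diamond α 3)^[n] (v (Sum.inr 0)) := by
  induction n with
  | zero => rfl
  | succ n ih =>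
    rw [Function.iterate_succ_apply', ← ih, iterTerm, Function.iterate_succ_apply']
    rfl

/-- The sentence `∀ x₀ x₁, x₁ = ◇3 … ◇3 x₀ → ¬ ψ`, with `n + 1` function symbols. -/
def haltSentence (ψ : Lang.BoundedFormula Empty 2) (n : ℕ) : Lang.Sentence :=
  Language.BoundedFormula.all (Language.BoundedFormula.all
    (((Language.BoundedFormula.equal (Language.var (Sum.inr 1)) (iterTerm (n + 1)))).imp
      (ψ.imp Language.BoundedFormula.falsum)))

theorem realize_haltSentence {α : ℕ∞} (ψ : Lang.BoundedFormula Empty 2) (n : ℕ) :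
    WN α ⊨ haltSentence ψ n ↔ ∀ c : WN α, ¬ ψ.Realize default ![c, num c n] := by
  rw [Language.Sentence.Realize, Language.Formula.Realize, haltSentence,
    Language.BoundedFormula.realize_all]
  refine forall_congr' fun c => ?_
  rw [Language.BoundedFormula.realize_all]
  have e : ∀ x : WN α, Fin.snoc (Fin.snoc default c) x = ![c, x] := fun x => by
    funext i
    fin_cases i <;> rfl
  have hx : ∀ x : WN α, (Language.BoundedFormula.equal (Language.var (Sum.inr 1))
      (iterTerm (n + 1))).Realize (default : Empty → WN α) ![c, x] ↔ x = num c n := fun x => by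
    change _ = (iterTerm (n + 1)).realize _ ↔ _
    rw [realize_iterTerm]
    rfl
  constructor
  · intro h hψ
    have := h (num c n)
    rw [e] at this
    exact this ((hx _).2 rfl) hψ
  · intro h x
    rw [e]
    intro h1 h2
    rw [(hx x).1 h1] at h2
    exact h h2

theorem computable_formulaCode_haltSentence (ψ : Lang.BoundedFormula Empty 2) :
    Computable fun n => formulaCode (haltSentence ψ n) := by
  have h1 : Primrec fun n : ℕ => (fun m => Nat.pair 2 m)^[n + 1] (Nat.pair 0 0) :=
    Primrec.nat_iterate Primrec.succ (Primrec.const _)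
      (Primrec₂.natPair.comp (Primrec.const 2) Primrec.snd).to₂
  have h2 : Primrec fun n : ℕ => Nat.pair 4 (Nat.pair 4 (Nat.pair 3 (Nat.pair
      (Nat.pair 1 (Nat.pair (Nat.pair 0 1) ((fun m => Nat.pair 2 m)^[n + 1] (Nat.pair 0 0))))
      (Nat.pair 3 (Nat.pair (formulaCode ψ) (Nat.pair 0 0)))))) :=
    Primrec₂.natPair.comp (Primrec.const _) (Primrec₂.natPair.comp (Primrec.const _)
      (Primrec₂.natPair.comp (Primrec.const _) (Primrec₂.natPair.comp
        (Primrec₂.natPair.comp (Primrec.const _) (Primrec₂.natPair.comp (Primrec.const _) h1))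
        (Primrec.const _))))
  refine h2.to_comp.of_eq fun n => ?_
  simp only [← termCode_iterTerm]
  rfl

theorem exists_boundedFormula {α : ℕ∞} {P : (Fin 2 → WN α) → Prop} (h : IsDef P) :
    ∃ ψ : Lang.BoundedFormula Empty 2, ∀ v, ψ.Realize default v ↔ P v := by
  obtain ⟨φ, hφ⟩ := h
  refine ⟨Language.BoundedFormula.relabel (n := 2) (k := 0) Sum.inr φ, fun v => ?_⟩
  rw [Language.BoundedFormula.realize_relabel, ← hφ, Language.Formula.Realize, iff_iff_eq]
  congr 1
  exact Subsingleton.elim _ _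

/-- If `F n` is defined, completeness gives a context `ctx k` that refutes the sentence. Conversely,
the sentence quantifies over all `c`, including bad ones, and there soundness in every context is
needed. -/
theorem exists_haltSentence {α : ℕ∞} (hα : 3 ≤ α) {F : ℕ →. ℕ} (hF : Nat.Partrec F) :
    ∃ ψ : Lang.BoundedFormula Empty 2, ∀ n, WN α ⊨ haltSentence ψ n ↔ ¬ (F n).Dom := by
  choose ctx hctx using exists_codes hα
  obtain ⟨R, hR⟩ := exists_represents hα hctx hF
  obtain ⟨ψ, hψ⟩ := exists_boundedFormula (P := fun v : Fin 2 → WN α => ∃ y, R (v 0) (v 1) y)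
    (IsDef.ex (hR.isDef _ _ _ _))
  refine ⟨ψ, fun n => ?_⟩
  simp only [realize_haltSentence, hψ]
  constructor
  · intro h hd
    obtain ⟨k, hk⟩ := (hR.complete (Part.get_mem hd)).exists
    exact h (ctx k) ⟨_, hk⟩
  · rintro h c ⟨y, hy⟩
    obtain ⟨j, hj, -⟩ := hR.sound hy
    exact h (Part.dom_iff_mem.2 ⟨j, hj⟩)

theorem not_decidableTheory_completeTheory {α : ℕ∞} (hα : 3 ≤ α) :
    ¬ DecidableTheory (Lang.completeTheory (WN α)) := by
  intro hdec
  -- The partial function runs the program with number `n` on the input `0`, so its domain is the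
  -- halting set.
  have hF : Nat.Partrec fun n => (Denumerable.ofNat Nat.Partrec.Code n).eval 0 :=
    Partrec.nat_iff.1 (Nat.Partrec.Code.eval_part.comp (Primrec.ofNat _).to_comp
      (Computable.const 0))
  obtain ⟨ψ, hψ⟩ := exists_haltSentence hα hF
  obtain ⟨hd, hcomp⟩ := hdec
  refine ComputablePred.halting_problem 0 (ComputablePred.of_eq (p := fun c =>
    ¬ ∃ φ : Lang.Sentence, φ ∈ Lang.completeTheory (WN α) ∧
      formulaCode φ = formulaCode (haltSentence ψ (Encodable.encode c)))
    (ComputablePred.not ⟨fun c => hd _, hcomp.comp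
      ((computable_formulaCode_haltSentence ψ).comp Computable.encode)⟩) fun c => ?_)
  have : (∃ φ : Lang.Sentence, φ ∈ Lang.completeTheory (WN α) ∧
      formulaCode φ = formulaCode (haltSentence ψ (Encodable.encode c))) ↔
      WN α ⊨ haltSentence ψ (Encodable.encode c) := by
    constructor
    · rintro ⟨φ, hφ, e⟩
      rw [← formulaCode_injective e]
      exact hφ
    · exact fun h => ⟨_, h, rfl⟩
  rw [this, hψ, Denumerable.ofNat_encode, not_not]

end ReflectionWords

theorem mainTheorem1 (α : ℕ∞) (hα : 3 ≤ α) :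
    ¬ ReflectionWords.DecidableTheory
        (ReflectionWords.Lang.completeTheory (ReflectionWords.WN α)) :=
  ReflectionWords.not_decidableTheory_completeTheory hα
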